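/- Let $\tau\in\mathbb R$ and let $\widetilde{PSL}_2(\mathbb R,\tau)$ be $\{(x,y,t)\in\mathbb R^3: y>0\}$ with the metric $\frac{dx^2+dy^2}{y^2}+\left(dt-\frac{2\tau}{y}dx\right)^2$; the maps $(x,y,t)\mapsto(x+s,y,t)$ are its parabolic isometries. A *complete parabolic $H$-surface* is a smooth immersion $X:\mathbb R^2\to\widetilde{PSL}_2(\mathbb R,\tau)$ with $X(p+(s,0))$ equal to $X(p)$ translated by $s$ in the $x$-direction, whose mean curvature is the constant $H$ for some continuous unit normal field, and whose induced metric is complete. Non-embedded means that the surface crosses itself transversally at some point. Theorem. Let $H>0$, $H\neq 1/2$. There is a family $\mathcal P_d$ of complete parabolic $H$-surfaces, indexed by $d\in\mathbb R$ if $0<H<1/2$ and by $d>0$ if $H>1/2$, such that $\mathcal P_d$ contains the points $(x,y,u(y))$, for all $x\in\mathbb R$ and all $y>0$ with $|dy-2H|<1$, where $u$ is a solution of $$u'(y)=\frac{(dy-2H)\sqrt{1+4\tau^2}}{y\sqrt{1-(dy-2H)^2}},$$ and moreover: 1. For $d>0$ and $H>1/2$, $\mathcal P_d$ is non-embedded,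 is invariant by a non-trivial vertical translation, and is contained in the closed region bounded by $y=y_1=\frac{2H-1}{d}$ and $y=y_2=\frac{2H+1}{d}$. 2. For $d>0$ and $0<H<1/2$, $\mathcal P_d$ is properly immersed and non-embedded, is symmetric with respect to the slice $t=0$, and the maximum value of $y$ on it is $y_2=\frac{2H+1}{d}$. 3. For $d=-c<0$ and $0<H<1/2$, $\mathcal P_d$ is properly embedded, is symmetric with respect to the slice $t=0$, and the maximum value of $y$ on it is $y_2=\frac{1-2H}{c}$. 4. For $0<H<1/2$, $\mathcal P_0$ is the graph $t=F(y)$, $y>0$, of $$F(y)=\frac{-2\sqrt{1+4\tau^2}\,H\ln y}{\sqrt{1-4H^2}},$$ and as $d\to0$, $d\ne 0$, suitable vertical translates of $\mathcal P_d$ tend to this graph smoothly on compact sets: inside each compact set the translate finally coincides with a smooth graph $t=v_d(y)$, and all derivatives of $v_d$ converge to those of $F$ locally uniformly on $(0,\infty)$. In 1, 2 and 3, $\mathcal P_d$ becomes, modulo the discrete group generated by any non-trivial parabolic translation $(x,y,t)\mapsto(x+L,y,t)$, a surface parametrized by an annulus. -/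

import Mathlib

open Set Filter Topology MeasureTheory
open scoped ContDiff

noncomputable section

namespace ParabolicPSL

/-- Coordinates `(x, y, t)` on the half-plane model of the ambient space. -/
abbrev Coords : Type := Fin 3 → ℝ

/-- The underlying set of the half-plane model: `y > 0`. -/
def ambient : Set Coords := {p | 0 < p 1}

/-- The conformal factor of the hyperbolic metric of the half-plane. -/
def conf (p : Coords) : ℝ := 1 / p 1

/-- The metric `λ² (dx² + dy²) + (-2 τ λ dx + dt)²` at the point `p`, as a bilinear expression in
the tangent vectors `v`, `w`. -/
def metric (τ : ℝ) (p v w : Coords) : ℝ :=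
  conf p ^ 2 * (v 0 * w 0 + v 1 * w 1)
    + (-2 * τ * conf p * v 0 + v 2) * (-2 * τ * conf p * w 0 + w 2)

/-- The coordinate vector fields. -/
def basisVec (i : Fin 3) : Coords := Pi.single i 1

/-- The coefficients of the metric. -/
def metricCoeff (τ : ℝ) (i j : Fin 3) (p : Coords) : ℝ := metric τ p (basisVec i) (basisVec j)

/-- The partial derivative `∂ₖ gᵢⱼ`. -/
def dMetric (τ : ℝ) (k i j : Fin 3) (p : Coords) : ℝ :=
  fderiv ℝ (metricCoeff τ i j) p (basisVec k)

/-- Christoffel symbols of the first kind of the Levi-Civita connection: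
`g(∇_{∂ᵢ} ∂ⱼ, ∂ₖ) = (∂ᵢ gⱼₖ + ∂ⱼ gᵢₖ - ∂ₖ gᵢⱼ) / 2`. -/
def christoffel (τ : ℝ) (i j k : Fin 3) (p : Coords) : ℝ :=
  (dMetric τ i j k p + dMetric τ j i k p - dMetric τ k i j p) / 2

/-- The coordinate directions of the parameter plane. -/
def dir : Fin 2 → ℝ × ℝ := ![(1, 0), (0, 1)]

/-- Partial derivatives of a parametrized surface. -/
def partialD (X : ℝ × ℝ → Coords) (a : Fin 2) (p : ℝ × ℝ) : Coords := fderiv ℝ X p (dir a)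

/-- First fundamental form. -/
def firstForm (τ : ℝ) (X : ℝ × ℝ → Coords) (a b : Fin 2) (p : ℝ × ℝ) : ℝ :=
  metric τ (X p) (partialD X a p) (partialD X b p)

/-- Second fundamental form `g(∇_{∂ₐ} ∂_b X, N)` with respect to the normal field `N`. -/
def secondForm (τ : ℝ) (X N : ℝ × ℝ → Coords) (a b : Fin 2) (p : ℝ × ℝ) : ℝ :=
  metric τ (X p) (partialD (partialD X b) a p) (N p)
    + ∑ i, ∑ j, ∑ k,
        christoffel τ i j k (X p) * partialD X a p i * partialD X b p j * N p k

/-- Mean curvature: half of the trace of the second fundamental form with respect to the first. -/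
def meanCurvature (τ : ℝ) (X N : ℝ × ℝ → Coords) (p : ℝ × ℝ) : ℝ :=
  (secondForm τ X N 0 0 p * firstForm τ X 1 1 p
      - 2 * secondForm τ X N 0 1 p * firstForm τ X 0 1 p
      + secondForm τ X N 1 1 p * firstForm τ X 0 0 p)
    / (2 * (firstForm τ X 0 0 p * firstForm τ X 1 1 p - firstForm τ X 0 1 p ^ 2))

/-- `N` is a continuous unit normal field along `X`. -/
def IsUnitNormal (τ : ℝ) (X N : ℝ × ℝ → Coords) : Prop :=
  Continuous N ∧ ∀ p, metric τ (X p) (N p) (N p) = 1 ∧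
    ∀ a, metric τ (X p) (partialD X a p) (N p) = 0

/-- Parabolic isometries: translations in the `x`-direction. -/
def parabolicTranslation (s : ℝ) (p : Coords) : Coords := ![p 0 + s, p 1, p 2]

/-- Vertical translations. -/
def verticalTranslation (s : ℝ) (p : Coords) : Coords := ![p 0, p 1, p 2 + s]

/-- Symmetry with respect to the slice `t = 0`. -/
def sliceReflection (p : Coords) : Coords := ![p 0, p 1, -p 2]

/-- Completeness of the metric induced by `X` on the parameter plane: every `C¹` half-line that
leaves all compact sets has infinite length. -/
def IsCompleteSurface (τ : ℝ) (X : ℝ × ℝ → Coords) : Prop :=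
  ∀ γ : ℝ → ℝ × ℝ, ContDiff ℝ 1 γ → Tendsto γ atTop (cocompact (ℝ × ℝ)) →
    ∫⁻ r in Ici (0 : ℝ),
      ENNReal.ofReal (√(metric τ (X (γ r)) (deriv (X ∘ γ) r) (deriv (X ∘ γ) r))) = ⊤

/-- `X` is a smooth immersion of the plane into the ambient space that is invariant by the
parabolic isometries, has constant mean curvature `H` for some continuous unit normal field, and is
complete. -/
structure IsCompleteParabolicHSurface (τ H : ℝ) (X : ℝ × ℝ → Coords) : Prop where
  mem_ambient : ∀ p, X p ∈ ambient
  smooth : ContDiff ℝ ∞ X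
  immersion : ∀ p, Function.Injective (fderiv ℝ X p)
  invariant : ∀ s p, X (p + (s, 0)) = parabolicTranslation s (X p)
  cmc : ∃ N, IsUnitNormal τ X N ∧ ∀ p, meanCurvature τ X N p = H
  complete : IsCompleteSurface τ X

/-- Properness of `X` as a map into the ambient space. -/
def IsProperSurface (X : ℝ × ℝ → Coords) : Prop :=
  ∀ K ⊆ ambient, IsCompact K → IsCompact (X ⁻¹' K)

/-- The surface crosses itself transversally somewhere; in particular neither the map `X` nor its
image is embedded. -/
def IsNonembedded (X : ℝ × ℝ → Coords) : Prop :=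
  ∃ p q, X p = X q ∧ range (fderiv ℝ X p) ≠ range (fderiv ℝ X q)

/-- Equivalence modulo the discrete group generated by the parabolic translation by `L`. -/
def parabolicSetoid (L : ℝ) : Setoid Coords where
  r p q := ∃ n : ℤ, q = parabolicTranslation (n * L) p
  iseqv :=
    { refl := fun p => ⟨0, by ext i; fin_cases i <;> simp [parabolicTranslation]⟩
      symm := by
        rintro p q ⟨n, rfl⟩
        exact ⟨-n, by ext i; fin_cases i <;> simp [parabolicTranslation]⟩
      trans := by
        rintro p q r ⟨n, rfl⟩ ⟨m, rfl⟩
        exact ⟨n + m, by ext i; fin_cases i <;> simp [parabolicTranslation]; ring⟩ }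

/-- Modulo any discrete group generated by a parabolic translation, `X` becomes a surface
parametrized by an annulus (circle times line). -/
def IsAnnulusModParabolic (X : ℝ × ℝ → Coords) : Prop :=
  ∀ L : ℝ, 0 < L → ∃ Y : AddCircle L × ℝ → Quotient (parabolicSetoid L),
    Continuous Y ∧ ∀ x s : ℝ, Y ((x : AddCircle L), s) = Quotient.mk _ (X (x, s))

/-- The derivative of the generating curve `t = u(y)` of a parabolic `H`-surface with
parameter `d`. -/
def profileDeriv (τ H d y : ℝ) : ℝ :=
  (d * y - 2 * H) * √(1 + 4 * τ ^ 2) / (y * √(1 - (d * y - 2 * H) ^ 2))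

/-- The surface `S` contains the graph `t = u(y)` of a primitive `u` of `profileDeriv τ H d`, over
the whole range of `y` where the latter is defined. -/
def ContainsProfile (τ H d : ℝ) (S : Set Coords) : Prop :=
  ∃ u : ℝ → ℝ, ∀ y, 0 < y → |d * y - 2 * H| < 1 →
    HasDerivAt u (profileDeriv τ H d y) y ∧ ∀ x : ℝ, ![x, y, u y] ∈ S

/-- The function whose graph is the limit surface. -/
def limitProfile (τ H y : ℝ) : ℝ :=
  -2 * √(1 + 4 * τ ^ 2) * H * Real.log y / √(1 - 4 * H ^ 2)

/-- The entire graph `t = F(y)`. -/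
def graphOf (F : ℝ → ℝ) : Set Coords := {q | 0 < q 1 ∧ q 2 = F (q 1)}

/-- As `d → 0`, `d ≠ 0`, the sets `S d` converge to the graph `t = F(y)` smoothly on compact subsets
of the ambient space: inside any compact set, `S d` finally coincides with a smooth graph
`t = v_d(y)`, and all derivatives of `v_d` converge locally uniformly to those of `F`. -/
def TendsSmoothlyToGraph (S : ℝ → Set Coords) (F : ℝ → ℝ) : Prop :=
  ∃ v : ℝ → ℝ → ℝ,
    (∀ K ⊆ ambient, IsCompact K → ∀ᶠ d in 𝓝[≠] 0, ∀ q ∈ K, q ∈ S d ↔ q 2 = v d (q 1)) ∧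
    (∀ C ⊆ Ioi (0 : ℝ), IsCompact C →
      ∀ᶠ d in 𝓝[≠] 0, ∃ U, IsOpen U ∧ C ⊆ U ∧ ContDiffOn ℝ ∞ (v d) U) ∧
    ∀ k : ℕ, TendstoLocallyUniformlyOn (fun d => iteratedDeriv k (v d)) (iteratedDeriv k F)
      (𝓝[≠] 0) (Ioi 0)

end ParabolicPSL

end

open ParabolicPSL

noncomputable section

namespace ParabolicPSL

/-! The quotient of the ambient space by the parabolic translations is the half-plane with metric
`dy²/y² + dt²/(1 + 4τ²)`. With `w = √(1 + 4τ²)`, an arc-length curve there satisfies `y' = y c`, `t'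
= w σ` with `c² + σ² = 1`, and the swept surface has mean curvature `H` as soon as `c' = -σ(σ + 2H)`
and `σ' = c(σ + 2H)`. This system has the first integral `(σ + 2H)/y = d`, that is `σ = dy - 2H`,
and eliminating `s` gives the stated equation for `u'`.

The graph over `y` breaks down where `c = 0`, but the variable `z = 1/y` removes the difficulty: it
solves the linear equation `z'' = 2Hd + (1 - 4H²) z` with energy `z² = z'² + (d - 2Hz)²`. Its
explicit solutions are a hyperbolic cosine (`H < 1/2`, `d ≠ 0`), an exponential (`d = 0`) and a
cosine (`H > 1/2`), all global and positive, so each gives a complete surface at once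
(`IsReciprocalProfile.isCompleteParabolicHSurface`).

The global shape follows from the symmetries of `z` and the sign of `σ`. A reflection of `z` is a
point symmetry of the height `t` (`height_add_reflect`), so a crossing is a further parameter at
which the height returns to its value at the centre; the intermediate value theorem supplies it. For
`d < 0` and `H < 1/2` the height is strictly monotone, whence embeddedness.

As `d → 0`, the branch `s < 0`, translated to pass through height `0` at `y = 1`, is a primitive of
a function smooth in `(d, y)` jointly, so it converges with all derivatives. The other branch leaves
every compact set, by the homogeneity of `z` in `d` (`height_coshRecip_mul`). -/

/-- The length of the projection of the unit vertical field, `√(1 + 4 τ²)`. -/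
def vertScale (τ : ℝ) : ℝ := √(1 + 4 * τ ^ 2)

lemma vertScale_sq (τ : ℝ) : vertScale τ ^ 2 = 1 + 4 * τ ^ 2 := Real.sq_sqrt (by positivity)

lemma vertScale_pos (τ : ℝ) : 0 < vertScale τ := Real.sqrt_pos.2 (by positivity)

/-! ### Derivatives of the ambient metric -/

/-- The derivatives of the metric coefficients with respect to `y`. -/
def metricDerivMatrix (τ y : ℝ) : Matrix (Fin 3) (Fin 3) ℝ :=
  !![-2 * (1 + 4 * τ ^ 2) / y ^ 3, 0, 2 * τ / y ^ 2; 0, -2 / y ^ 3, 0; 2 * τ / y ^ 2, 0, 0]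

lemma metricCoeff_hasDerivAt (τ : ℝ) (i j : Fin 3) {y : ℝ} (hy : 0 < y) :
    HasDerivAt (fun v => metricCoeff τ i j ![0, v, 0]) (metricDerivMatrix τ y i j) y := by
  have hy' : y ≠ 0 := hy.ne'
  have h1 : HasDerivAt (fun v : ℝ => v⁻¹) (-(y ^ 2)⁻¹) y := hasDerivAt_inv hy'
  have h2 : HasDerivAt (fun v : ℝ => (v ^ 2)⁻¹) (-2 / y ^ 3) y := by
    refine ((hasDerivAt_pow 2 y).inv (by positivity)).congr_deriv ?_
    field_simp
    simp [mul_comm]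
  have h3 : HasDerivAt (fun v : ℝ => -(2 * τ * v⁻¹)) (2 * τ / y ^ 2) y := by
    refine (h1.const_mul (2 * τ)).neg.congr_deriv ?_
    field_simp
  fin_cases i <;> fin_cases j <;>
    simp [metricCoeff, metric, conf, basisVec, metricDerivMatrix]
  · refine (h2.add (((h1.const_mul (2 * τ))).mul (h1.const_mul (2 * τ)))).congr_deriv ?_
    field_simp
    ring
  · exact hasDerivAt_const _ _
  · exact h3
  · exact hasDerivAt_const _ _
  · exact h2
  · exact hasDerivAt_const _ _
  · exact h3
  · exact hasDerivAt_const _ _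
  · exact hasDerivAt_const _ _

lemma dMetric_eq (τ : ℝ) (k i j : Fin 3) {p : Coords} (hp : 0 < p 1) :
    dMetric τ k i j p = if k = 1 then metricDerivMatrix τ (p 1) i j else 0 := by
  have h1 : HasFDerivAt (fun q : Coords => q 1) (ContinuousLinearMap.proj (R := ℝ) 1) p :=
    hasFDerivAt_apply _ _
  have h2 := (metricCoeff_hasDerivAt τ i j hp).comp_hasFDerivAt p h1
  have h3 : metricCoeff τ i j = (fun v => metricCoeff τ i j ![0, v, 0]) ∘ fun q : Coords => q 1 := by
    ext q; simp [metricCoeff, metric, conf]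
  rw [dMetric, h3, h2.fderiv]
  by_cases hk : k = 1
  · simp [hk, basisVec]
  · simp [hk, basisVec, Ne.symm hk]

/-! ### Swept surfaces: tangent vectors, normal and mean curvature -/

/-- The surface swept out by the curve `(y, t)` under the parabolic translations. -/
def sweep (y t : ℝ → ℝ) (p : ℝ × ℝ) : Coords := ![p.1, y p.2, t p.2]

lemma sweep_contDiff {y t : ℝ → ℝ} (hy : ContDiff ℝ ∞ y) (ht : ContDiff ℝ ∞ t) :
    ContDiff ℝ ∞ (sweep y t) := by
  refine contDiff_pi.2 fun i => ?_
  fin_cases i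
  · exact contDiff_fst
  · exact hy.comp contDiff_snd
  · exact ht.comp contDiff_snd

/-- The factor `c` serves two cases: `1` gives the surface itself, `0` its tangent field in the
`s`-direction. -/
lemma fderiv_sweep_aux {c y1 t1 : ℝ} {y t : ℝ → ℝ} {p : ℝ × ℝ} (hy : HasDerivAt y y1 p.2)
    (ht : HasDerivAt t t1 p.2) (v : ℝ × ℝ) :
    fderiv ℝ (fun q : ℝ × ℝ => (![c * q.1, y q.2, t q.2] : Coords)) p v
      = ![c * v.1, v.2 * y1, v.2 * t1] := by
  have h : HasFDerivAt (fun q : ℝ × ℝ => (![c * q.1, y q.2, t q.2] : Coords))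
      (ContinuousLinearMap.pi ![c • ContinuousLinearMap.fst ℝ ℝ ℝ,
        y1 • ContinuousLinearMap.snd ℝ ℝ ℝ, t1 • ContinuousLinearMap.snd ℝ ℝ ℝ]) p := by
    refine hasFDerivAt_pi.2 fun i => ?_
    fin_cases i
    · exact hasFDerivAt_fst.const_mul c
    · exact hy.comp_hasFDerivAt p hasFDerivAt_snd
    · exact ht.comp_hasFDerivAt p hasFDerivAt_snd
  rw [h.fderiv]
  ext i
  fin_cases i <;> simp [mul_comm]

lemma fderiv_sweep {y1 t1 : ℝ} {y t : ℝ → ℝ} {p : ℝ × ℝ} (hy : HasDerivAt y y1 p.2)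
    (ht : HasDerivAt t t1 p.2) (v : ℝ × ℝ) :
    fderiv ℝ (sweep y t) p v = ![v.1, v.2 * y1, v.2 * t1] := by
  have h := fderiv_sweep_aux (c := 1) hy ht v
  simp only [one_mul] at h
  exact h

lemma partialD_sweep {y1 t1 y t : ℝ → ℝ} (hy : ∀ s, HasDerivAt y (y1 s) s)
    (ht : ∀ s, HasDerivAt t (t1 s) s) :
    partialD (sweep y t) 0 = (fun _ => ![1, 0, 0]) ∧
      partialD (sweep y t) 1 = fun p => ![0, y1 p.2, t1 p.2] := by
  constructor <;> ext p i <;> rw [partialD, fderiv_sweep (hy _) (ht _)] <;> fin_cases i <;>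
    simp [dir]

lemma partialD_partialD_sweep {y1 t1 y t y2 t2 : ℝ → ℝ} (hy : ∀ s, HasDerivAt y (y1 s) s)
    (ht : ∀ s, HasDerivAt t (t1 s) s) (hy' : ∀ s, HasDerivAt y1 (y2 s) s)
    (ht' : ∀ s, HasDerivAt t1 (t2 s) s) (p : ℝ × ℝ) :
    partialD (partialD (sweep y t) 0) 0 p = 0 ∧ partialD (partialD (sweep y t) 1) 0 p = 0 ∧
      partialD (partialD (sweep y t) 1) 1 p = ![0, y2 p.2, t2 p.2] := by
  have h : ∀ v, fderiv ℝ (fun p : ℝ × ℝ => (![0, y1 p.2, t1 p.2] : Coords)) p v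
      = ![0, v.2 * y2 p.2, v.2 * t2 p.2] := by
    intro v
    have h := fderiv_sweep_aux (c := 0) (hy' p.2) (ht' p.2) v
    simp only [zero_mul] at h
    exact h
  rw [(partialD_sweep hy ht).1, (partialD_sweep hy ht).2]
  refine ⟨by simp [partialD], ?_, ?_⟩
  · rw [partialD, h]; ext i; fin_cases i <;> simp [dir]
  · rw [partialD, h]; ext i; fin_cases i <;> simp [dir]

/-- The unit normal of a swept surface whose profile has orbit-space velocity `(c, σ)`. -/
def sweepNormal (τ : ℝ) (y c σ : ℝ → ℝ) (p : ℝ × ℝ) : Coords :=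
  ![2 * τ * c p.2 * y p.2 / vertScale τ, -σ p.2 * y p.2, vertScale τ * c p.2]

lemma meanCurvature_sweep {τ H : ℝ} {y t c σ : ℝ → ℝ} (hpos : ∀ s, 0 < y s)
    (hcs : ∀ s, c s ^ 2 + σ s ^ 2 = 1)
    (hy : ∀ s, HasDerivAt y (y s * c s) s) (ht : ∀ s, HasDerivAt t (vertScale τ * σ s) s)
    (hc : ∀ s, HasDerivAt c (-σ s * (σ s + 2 * H)) s)
    (hσ : ∀ s, HasDerivAt σ (c s * (σ s + 2 * H)) s) (p : ℝ × ℝ) :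
    meanCurvature τ (sweep y t) (sweepNormal τ y c σ) p = H := by
  obtain ⟨h00, h01, h11⟩ := partialD_partialD_sweep hy ht (fun s => (hy s).mul (hc s))
    (fun s => (hσ s).const_mul (vertScale τ)) p
  obtain ⟨h0, h1⟩ := partialD_sweep hy ht
  have hy0 : 0 < y p.2 := hpos _
  have hX : 0 < sweep y t p 1 := hy0
  have hX1 : sweep y t p 1 = y p.2 := rfl
  have hw := vertScale_sq τ
  have hw0 := vertScale_pos τ
  have hcs' := hcs p.2
  simp only [meanCurvature, secondForm, firstForm]
  rw [h00, h01, h11]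
  simp only [christoffel, dMetric_eq _ _ _ _ hX,
    hX1, h0, h1, metric, conf, Fin.sum_univ_three, sweepNormal, metricDerivMatrix]
  simp
  generalize y p.2 = Y at *
  generalize c p.2 = C at *
  generalize σ p.2 = S at *
  generalize vertScale τ = w at *
  have hE : (Y ^ 2)⁻¹ + 2 * τ * Y⁻¹ * (2 * τ * Y⁻¹) = w ^ 2 / Y ^ 2 := by
    rw [hw]; field_simp; ring
  -- The determinant of the first form equals its `x`-coefficient, because `s` is arc length in the
  -- orbit space.
  have hD : w ^ 2 / Y ^ 2 * ((Y ^ 2)⁻¹ * (Y * C * (Y * C)) + w * S * (w * S)) -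
      (2 * τ * Y⁻¹ * (w * S)) ^ 2 = w ^ 2 / Y ^ 2 := by
    field_simp
    linear_combination S ^ 2 * hw + hcs'
  rw [hE, hD]
  clear hD hE h11 hσ hc hy ht h1 h0 h01 h00 hX hX1 hpos hcs
  field_simp
  grind

lemma isUnitNormal_sweep {τ : ℝ} {y t c σ : ℝ → ℝ} (hpos : ∀ s, 0 < y s)
    (hcs : ∀ s, c s ^ 2 + σ s ^ 2 = 1)
    (hy : ∀ s, HasDerivAt y (y s * c s) s) (ht : ∀ s, HasDerivAt t (vertScale τ * σ s) s)
    (hc : Continuous c) (hσ : Continuous σ) :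
    IsUnitNormal τ (sweep y t) (sweepNormal τ y c σ) := by
  obtain ⟨h0, h1⟩ := partialD_sweep hy ht
  have hyc : Continuous y := continuous_iff_continuousAt.2 fun s => (hy s).continuousAt
  refine ⟨?_, fun p => ?_⟩
  · refine continuous_pi fun i => ?_
    have := (vertScale_pos τ).ne'
    fin_cases i <;> simp only [sweepNormal] <;> simp <;> fun_prop
  have hX1 : sweep y t p 1 = y p.2 := rfl
  have hy0 : 0 < y p.2 := hpos _
  have hw := vertScale_sq τ
  have hw0 := vertScale_pos τ
  have hcs' := hcs p.2
  refine ⟨?_, fun a => ?_⟩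
  · simp only [metric, conf, hX1, sweepNormal]
    simp
    field_simp
    linear_combination (c p.2 ^ 2 * (vertScale τ ^ 2 - 4 * τ ^ 2)) * hw + vertScale τ ^ 2 * hcs'
  · fin_cases a
    · simp [h0, metric, conf, hX1, sweepNormal]
      field_simp
      linear_combination (-2*τ*c p.2) * hw
    · simp [h1, metric, conf, hX1, sweepNormal]
      field_simp
      linear_combination c p.2 * σ p.2 * hw

/-! ### Completeness of swept surfaces -/

lemma abs_sub_le_of_abs_deriv_le {f f' g : ℝ → ℝ} {C r : ℝ} (hr : 0 ≤ r)
    (hf : ∀ s, HasDerivAt f (f' s) s) (hf' : Continuous f') (hg : Continuous g)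
    (hg0 : ∀ s, 0 ≤ g s) (hgi : IntegrableOn g (Ici 0)) (hC : 0 ≤ C)
    (hle : ∀ s, 0 ≤ s → |f' s| ≤ C * g s) :
    |f r - f 0| ≤ C * ∫ s in Ici 0, g s := by
  rw [← intervalIntegral.integral_eq_sub_of_hasDerivAt (fun s _ => hf s)
    (hf'.intervalIntegrable 0 r)]
  have h1 : |∫ s in (0 : ℝ)..r, f' s| ≤ ∫ s in (0 : ℝ)..r, C * g s := by
    refine (intervalIntegral.abs_integral_le_integral_abs hr).trans ?_
    exact intervalIntegral.integral_mono_on hr (hf'.abs.intervalIntegrable _ _)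
      ((hg.const_mul C).intervalIntegrable _ _) fun s hs => hle s hs.1
  refine h1.trans ?_
  rw [intervalIntegral.integral_const_mul, intervalIntegral.integral_of_le hr]
  refine mul_le_mul_of_nonneg_left ?_ hC
  exact setIntegral_mono_set hgi (Eventually.of_forall hg0)
    (Eventually.of_forall fun s hs => (hs.1.le : (0 : ℝ) ≤ s))

/-- Splitting off the orbit-space speed `b` leaves a square, the component along the orbit. -/
lemma metric_sweep_velocity {τ Y C S : ℝ} (hY : 0 < Y) (hCS : C ^ 2 + S ^ 2 = 1) {p : Coords}
    (hp : p 1 = Y) (a b : ℝ) :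
    metric τ p ![a, b * (Y * C), b * (vertScale τ * S)] ![a, b * (Y * C), b * (vertScale τ * S)]
      = b ^ 2 + (vertScale τ * a / Y - 2 * τ * S * b) ^ 2 := by
  have hw := vertScale_sq τ
  simp [metric, conf, hp]
  field_simp
  linear_combination b ^ 2 * Y ^ 2 * hCS + (Y ^ 2 * S ^ 2 * b ^ 2 - a ^ 2) * hw

/-- On a path of finite length the parameter `s` stays bounded, since length dominates its
variation. Then `y` is bounded, so the orbit component of the speed controls `x'` as well. The path
stays in a compact box and cannot escape. -/
lemma isCompleteSurface_sweep {τ : ℝ} {y t c σ : ℝ → ℝ} (hpos : ∀ s, 0 < y s)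
    (hcs : ∀ s, c s ^ 2 + σ s ^ 2 = 1)
    (hy : ∀ s, HasDerivAt y (y s * c s) s) (ht : ∀ s, HasDerivAt t (vertScale τ * σ s) s)
    (hσ : Continuous σ) : IsCompleteSurface τ (sweep y t) := by
  intro γ hγ hlim
  by_contra hfin
  have hyc : Continuous y := continuous_iff_continuousAt.2 fun s => (hy s).continuousAt
  have hd : ∀ r, HasDerivAt γ (deriv γ r) r := fun r =>
    (hγ.differentiable one_ne_zero r).hasDerivAt
  have hdc : Continuous (deriv γ) := hγ.continuous_deriv le_rfl
  have hx : ∀ r, HasDerivAt (fun r => (γ r).1) (deriv γ r).1 r := fun r =>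
    (hasFDerivAt_fst (p := γ r)).comp_hasDerivAt r (hd r)
  have hs : ∀ r, HasDerivAt (fun r => (γ r).2) (deriv γ r).2 r := fun r =>
    (hasFDerivAt_snd (p := γ r)).comp_hasDerivAt r (hd r)
  set g : ℝ → ℝ := fun r => √((deriv γ r).2 ^ 2 + (vertScale τ * (deriv γ r).1 / y (γ r).2
    - 2 * τ * σ (γ r).2 * (deriv γ r).2) ^ 2) with hgdef
  have hspeed : ∀ r, √(metric τ (sweep y t (γ r)) (deriv (sweep y t ∘ γ) r)
      (deriv (sweep y t ∘ γ) r)) = g r := by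
    intro r
    have h : HasDerivAt (sweep y t ∘ γ) ![(deriv γ r).1, (deriv γ r).2 * (y (γ r).2 * c (γ r).2),
        (deriv γ r).2 * (vertScale τ * σ (γ r).2)] r := by
      refine hasDerivAt_pi.2 fun i => ?_
      fin_cases i
      · exact hx r
      · exact ((hy (γ r).2).comp r (hs r)).congr_deriv (mul_comm _ _)
      · exact ((ht (γ r).2).comp r (hs r)).congr_deriv (mul_comm _ _)
    rw [h.deriv, metric_sweep_velocity (hpos (γ r).2) (hcs _) rfl]
  simp only [hspeed] at hfin
  have hγc := hγ.continuous
  have hg : Continuous g := by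
    have hne : ∀ r, y (γ r).2 ≠ 0 := fun r => (hpos _).ne'
    simp only [hgdef]
    fun_prop (disch := assumption)
  have hg0 : ∀ r, 0 ≤ g r := fun r => Real.sqrt_nonneg _
  have hgi : IntegrableOn g (Ici 0) :=
    (lintegral_ofReal_ne_top_iff_integrable hg.aestronglyMeasurable
      (Eventually.of_forall hg0)).1 hfin
  set len := ∫ s in Ici (0 : ℝ), g s
  have hslen : ∀ r, 0 ≤ r → |(γ r).2 - (γ 0).2| ≤ 1 * len := fun r hr =>
    abs_sub_le_of_abs_deriv_le hr hs hdc.snd hg hg0 hgi zero_le_one fun s _ => by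
      rw [one_mul]
      exact Real.abs_le_sqrt (by nlinarith [sq_nonneg (vertScale τ * (deriv γ s).1 / y (γ s).2
        - 2 * τ * σ (γ s).2 * (deriv γ s).2)])
  simp only [one_mul] at hslen
  obtain ⟨M, hM⟩ := (isCompact_Icc (a := (γ 0).2 - len) (b := (γ 0).2 + len)).bddAbove_image
    hyc.continuousOn
  have hyM : ∀ r, 0 ≤ r → y (γ r).2 ≤ M := fun r hr => hM ⟨_, by
    have := abs_le.1 (hslen r hr); constructor <;> linarith, rfl⟩
  have hw := vertScale_pos τ
  have hM0 : 0 < M := (hpos _).trans_le (hyM 0 le_rfl)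
  have hxlen : ∀ r, 0 ≤ r → |(γ r).1 - (γ 0).1| ≤ M * (1 + 2 * |τ|) / vertScale τ * len := by
    intro r hr
    refine abs_sub_le_of_abs_deriv_le hr hx hdc.fst hg hg0 hgi (by positivity) fun s hs0 => ?_
    have hY := hpos (γ s).2
    have h1 : |(deriv γ s).2| ≤ g s := Real.abs_le_sqrt (by
      nlinarith [sq_nonneg (vertScale τ * (deriv γ s).1 / y (γ s).2
        - 2 * τ * σ (γ s).2 * (deriv γ s).2)])
    have h2 : |vertScale τ * (deriv γ s).1 / y (γ s).2 - 2 * τ * σ (γ s).2 * (deriv γ s).2|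
        ≤ g s := Real.abs_le_sqrt (by nlinarith [sq_nonneg (deriv γ s).2])
    have h3 : |2 * τ * σ (γ s).2 * (deriv γ s).2| ≤ 2 * |τ| * g s := by
      have : |σ (γ s).2| ≤ 1 := by
        rw [← sq_le_one_iff_abs_le_one]; nlinarith [hcs (γ s).2, sq_nonneg (c (γ s).2)]
      rw [abs_mul, abs_mul, abs_mul, abs_two]
      calc 2 * |τ| * |σ (γ s).2| * |(deriv γ s).2| ≤ 2 * |τ| * 1 * g s := by gcongr
        _ = _ := by ring
    have h4 : |vertScale τ * (deriv γ s).1 / y (γ s).2| ≤ (1 + 2 * |τ|) * g s := by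
      rw [abs_le] at *
      constructor <;> linarith [h2.1, h2.2, h3.1, h3.2]
    rw [abs_div, abs_mul, abs_of_pos hw, abs_of_pos hY, div_le_iff₀ hY] at h4
    have h5 : (1 + 2 * |τ|) * g s * y (γ s).2 ≤ (1 + 2 * |τ|) * g s * M :=
      mul_le_mul_of_nonneg_left (hyM s hs0) (mul_nonneg (by positivity) (hg0 s))
    rw [div_mul_eq_mul_div, le_div_iff₀ hw]
    linarith
  have hK : IsCompact (Icc ((γ 0).1 - M * (1 + 2 * |τ|) / vertScale τ * len)
      ((γ 0).1 + M * (1 + 2 * |τ|) / vertScale τ * len) ×ˢ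
      Icc ((γ 0).2 - len) ((γ 0).2 + len)) := isCompact_Icc.prod isCompact_Icc
  obtain ⟨r, hr, hr0⟩ := ((hlim.eventually hK.compl_mem_cocompact).and
    (eventually_ge_atTop 0)).exists
  refine hr ⟨?_, ?_⟩
  · have := abs_le.1 (hxlen r hr0); constructor <;> linarith
  · have := abs_le.1 (hslen r hr0); constructor <;> linarith

/-! ### From reciprocal profiles to complete `H`-surfaces -/

/-- `z` is the reciprocal `1 / y` of the `y`-coordinate along the generating curve of a parabolic
`H`-surface with parameter `d`, in terms of the orbit-space arc length; `z₁` is its derivative. -/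
structure IsReciprocalProfile (H d : ℝ) (z z₁ : ℝ → ℝ) : Prop where
  pos : ∀ s, 0 < z s
  smooth : ContDiff ℝ ∞ z
  hasDerivAt : ∀ s, HasDerivAt z (z₁ s) s
  hasDerivAt_deriv : ∀ s, HasDerivAt z₁ (2 * H * d + (1 - 4 * H ^ 2) * z s) s
  energy : ∀ s, z s ^ 2 = z₁ s ^ 2 + (d - 2 * H * z s) ^ 2

/-- The `t`-coordinate along the generating curve. -/
def height (τ H d : ℝ) (z : ℝ → ℝ) (s : ℝ) : ℝ := ∫ r in (0 : ℝ)..s, vertScale τ * (d / z r - 2 * H)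

/-- The parabolic surface with generating curve `(1 / z, height)`. -/
def profileSurface (τ H d : ℝ) (z : ℝ → ℝ) : ℝ × ℝ → Coords :=
  sweep (fun s => (z s)⁻¹) (height τ H d z)

namespace IsReciprocalProfile

variable {τ H d : ℝ} {z z₁ : ℝ → ℝ}

/-- The energy identity divided by `z²`: the velocity in the orbit space is `(c, σ) = (-z₁/z, d/z -
2H)`. -/
lemma angle_sq (h : IsReciprocalProfile H d z z₁) (s : ℝ) :
    (-z₁ s / z s) ^ 2 + (d / z s - 2 * H) ^ 2 = 1 := by
  have := h.pos s
  field_simp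
  linear_combination -h.energy s

lemma continuous_angle (h : IsReciprocalProfile H d z z₁) :
    Continuous fun s => d / z s - 2 * H :=
  (continuous_const.div h.smooth.continuous fun s => (h.pos s).ne').sub continuous_const

lemma hasDerivAt_inv (h : IsReciprocalProfile H d z z₁) (s : ℝ) :
    HasDerivAt (fun s => (z s)⁻¹) ((z s)⁻¹ * (-z₁ s / z s)) s := by
  have := h.pos s
  refine ((h.hasDerivAt s).inv this.ne').congr_deriv ?_
  field_simp

lemma hasDerivAt_height (h : IsReciprocalProfile H d z z₁) (s : ℝ) :
    HasDerivAt (height τ H d z) (vertScale τ * (d / z s - 2 * H)) s :=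
  (h.continuous_angle.const_mul _).integral_hasStrictDerivAt 0 s |>.hasDerivAt

lemma contDiff_height (h : IsReciprocalProfile H d z z₁) : ContDiff ℝ ∞ (height τ H d z) := by
  refine contDiff_infty_iff_deriv.2 ⟨fun s => h.hasDerivAt_height s |>.differentiableAt, ?_⟩
  rw [funext fun s => (h.hasDerivAt_height (τ := τ) s).deriv]
  exact contDiff_const.mul ((contDiff_const.div h.smooth fun s => (h.pos s).ne').sub contDiff_const)

theorem isCompleteParabolicHSurface (h : IsReciprocalProfile H d z z₁) :
    IsCompleteParabolicHSurface τ H (profileSurface τ H d z) := by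
  have hpos : ∀ s, 0 < (z s)⁻¹ := fun s => inv_pos.2 (h.pos s)
  have hσ : ∀ s, HasDerivAt (fun s => d / z s - 2 * H)
      (-z₁ s / z s * ((d / z s - 2 * H) + 2 * H)) s := by
    intro s
    have := h.pos s
    refine (((hasDerivAt_const s d).div (h.hasDerivAt s) this.ne').sub_const (2 * H)).congr_deriv ?_
    field_simp
    ring
  have hc : ∀ s, HasDerivAt (fun s => -z₁ s / z s)
      (-(d / z s - 2 * H) * ((d / z s - 2 * H) + 2 * H)) s := by
    intro s
    have := h.pos s
    refine ((h.hasDerivAt_deriv s).neg.div (h.hasDerivAt s) this.ne').congr_deriv ?_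
    simp only [Pi.neg_apply]
    field_simp
    linear_combination -h.energy s
  have hcc : Continuous fun s => -z₁ s / z s :=
    continuous_iff_continuousAt.2 fun s => (hc s).continuousAt
  exact
  { mem_ambient := fun p => hpos p.2
    smooth := sweep_contDiff (h.smooth.inv fun s => (h.pos s).ne') h.contDiff_height
    immersion := by
      intro p
      rw [injective_iff_map_eq_zero]
      intro v hv
      rw [profileSurface, fderiv_sweep (h.hasDerivAt_inv p.2) (h.hasDerivAt_height p.2)] at hv
      have h0 : v.1 = 0 := congrFun hv 0
      have h1 : v.2 * ((z p.2)⁻¹ * (-z₁ p.2 / z p.2)) = 0 := congrFun hv 1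
      have h2 : v.2 * (vertScale τ * (d / z p.2 - 2 * H)) = 0 := congrFun hv 2
      have hw := vertScale_pos τ
      refine Prod.ext h0 ?_
      by_contra hne
      replace hne : v.2 ≠ 0 := hne
      have h3 : -z₁ p.2 / z p.2 = 0 := by simpa [hne, (h.pos _).ne'] using h1
      have h4 : d / z p.2 - 2 * H = 0 := by simpa [hne, hw.ne'] using h2
      have := h.angle_sq p.2
      rw [h3, h4] at this
      norm_num at this
    invariant := by
      intro s p
      ext i
      fin_cases i <;> simp [profileSurface, sweep, parabolicTranslation]
    cmc := ⟨sweepNormal τ (fun s => (z s)⁻¹) (fun s => -z₁ s / z s) (fun s => d / z s - 2 * H),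
      isUnitNormal_sweep hpos h.angle_sq h.hasDerivAt_inv h.hasDerivAt_height hcc
        h.continuous_angle,
      meanCurvature_sweep hpos h.angle_sq h.hasDerivAt_inv h.hasDerivAt_height hc hσ⟩
    complete := isCompleteSurface_sweep hpos h.angle_sq h.hasDerivAt_inv h.hasDerivAt_height
      h.continuous_angle }

end IsReciprocalProfile

/-! ### The generating curve as a graph over `y` -/

/-- The parameters `(d, y)` at which `profileDeriv` is defined. -/
def profileDomain (H : ℝ) : Set (ℝ × ℝ) := {q | 0 < q.2 ∧ |q.1 * q.2 - 2 * H| < 1}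

lemma isOpen_profileDomain (H : ℝ) : IsOpen (profileDomain H) :=
  (isOpen_lt continuous_const continuous_snd).inter
    (isOpen_lt ((continuous_fst.mul continuous_snd).sub continuous_const).abs continuous_const)

lemma contDiffOn_profileDeriv (τ H : ℝ) :
    ContDiffOn ℝ ∞ (fun q : ℝ × ℝ => profileDeriv τ H q.1 q.2) (profileDomain H) := by
  intro q hq
  have h1 : 0 < 1 - (q.1 * q.2 - 2 * H) ^ 2 := by
    have := (sq_lt_one_iff_abs_lt_one _).2 hq.2; linarith
  have h2 := Real.sqrt_pos.2 h1
  have hq1 := hq.1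
  refine ContDiffAt.contDiffWithinAt ?_
  unfold profileDeriv
  refine ContDiffAt.div (by fun_prop) ?_ (by positivity)
  exact contDiffAt_snd.mul (ContDiffAt.sqrt (by fun_prop) h1.ne')

lemma continuousOn_profileDeriv {τ H d : ℝ} :
    ContinuousOn (profileDeriv τ H d) {y | (d, y) ∈ profileDomain H} :=
  (contDiffOn_profileDeriv τ H).continuousOn.comp (f := fun y => (d, y)) (by fun_prop)
    fun _ hy => hy

lemma ordConnected_profileDomain {H d : ℝ} : OrdConnected {y | (d, y) ∈ profileDomain H} := by
  refine ⟨fun a ha b hb y hy => ⟨ha.1.trans_le hy.1, ?_⟩⟩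
  have h1 := abs_lt.1 ha.2
  have h2 := abs_lt.1 hb.2
  simp only at h1 h2
  rw [abs_lt]
  rcases le_total 0 d with hd | hd
  · have := mul_le_mul_of_nonneg_left hy.1 hd
    have := mul_le_mul_of_nonneg_left hy.2 hd
    constructor <;> simp only <;> linarith
  · have := mul_le_mul_of_nonpos_left hy.1 hd
    have := mul_le_mul_of_nonpos_left hy.2 hd
    constructor <;> simp only <;> linarith

lemma hasDerivAt_integral_profileDeriv {τ H d a y : ℝ} (ha : (d, a) ∈ profileDomain H)
    (hy : (d, y) ∈ profileDomain H) :
    HasDerivAt (fun y => ∫ v in a..y, profileDeriv τ H d v) (profileDeriv τ H d y) y := by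
  have hopen : IsOpen {y | (d, y) ∈ profileDomain H} :=
    (isOpen_profileDomain H).preimage (by fun_prop)
  refine intervalIntegral.integral_hasDerivAt_right ?_ ?_ ?_
  · exact (continuousOn_profileDeriv.mono
      (ordConnected_profileDomain.uIcc_subset ha hy)).intervalIntegrable
  · exact continuousOn_profileDeriv.stronglyMeasurableAtFilter hopen _ hy
  · exact continuousOn_profileDeriv.continuousAt (hopen.mem_nhds hy)

namespace IsReciprocalProfile

variable {τ H d : ℝ} {z z₁ : ℝ → ℝ}

lemma mem_profileDomain (h : IsReciprocalProfile H d z z₁) {s : ℝ} (hs : z₁ s < 0) :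
    (d, (z s)⁻¹) ∈ profileDomain H := by
  refine ⟨inv_pos.2 (h.pos s), ?_⟩
  rw [← sq_lt_one_iff_abs_lt_one, ← h.angle_sq s, div_eq_mul_inv d]
  have : 0 < -z₁ s / z s := div_pos (neg_pos.2 hs) (h.pos s)
  have := pow_pos this 2
  simp only
  linarith

/-- The chain rule `u'(y) y' = t'`. The square root in `profileDeriv` is `c` itself and not `-c`,
because `y` increases where `z₁ < 0`. -/
lemma profileDeriv_inv (h : IsReciprocalProfile H d z z₁) {s : ℝ} (hs : z₁ s < 0) :
    profileDeriv τ H d (z s)⁻¹ * ((z s)⁻¹ * (-z₁ s / z s)) = vertScale τ * (d / z s - 2 * H) := by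
  have hp := h.pos s
  have h1 : √(1 - (d * (z s)⁻¹ - 2 * H) ^ 2) = -z₁ s / z s := by
    rw [show 1 - (d * (z s)⁻¹ - 2 * H) ^ 2 = (-z₁ s / z s) ^ 2 by
      rw [← h.angle_sq s]; ring]
    exact Real.sqrt_sq (div_pos (neg_pos.2 hs) hp).le
  have h2 : -z₁ s / z s ≠ 0 := (div_pos (neg_pos.2 hs) hp).ne'
  rw [profileDeriv, h1, ← vertScale, div_mul_cancel₀ _ (mul_ne_zero (inv_pos.2 hp).ne' h2)]
  ring

lemma height_eq_add_integral (h : IsReciprocalProfile H d z z₁) {I : Set ℝ} (hI : IsOpen I)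
    (hI' : IsPreconnected I) (hneg : ∀ s ∈ I, z₁ s < 0) {s₀ s : ℝ} (hs₀ : s₀ ∈ I) (hs : s ∈ I) :
    height τ H d z s
      = height τ H d z s₀ + ∫ v in (z s₀)⁻¹..(z s)⁻¹, profileDeriv τ H d v := by
  have hder : ∀ s ∈ I, HasDerivAt (fun s => height τ H d z s
      - ∫ v in (z s₀)⁻¹..(z s)⁻¹, profileDeriv τ H d v) 0 s := by
    intro s hs
    have h1 := (hasDerivAt_integral_profileDeriv (τ := τ) (h.mem_profileDomain (hneg _ hs₀))
      (h.mem_profileDomain (hneg _ hs))).comp s (h.hasDerivAt_inv s)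
    refine ((h.hasDerivAt_height (τ := τ) s).sub h1).congr_deriv ?_
    rw [h.profileDeriv_inv (hneg s hs), sub_self]
  have := hI.is_const_of_deriv_eq_zero hI'
    (fun s hs => (hder s hs).differentiableAt.differentiableWithinAt)
    (fun s hs => (hder s hs).deriv) hs hs₀
  simp only [intervalIntegral.integral_same] at this
  linarith

/-- `I` is a branch on which `y` increases; there the height is a primitive of `profileDeriv`
evaluated at `y`, and `hsurj` says that the branch covers the whole domain. -/
theorem containsProfile (h : IsReciprocalProfile H d z z₁) {I : Set ℝ} (hI : IsOpen I)
    (hI' : IsPreconnected I) (hneg : ∀ s ∈ I, z₁ s < 0)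
    (hsurj : ∀ y, 0 < y → |d * y - 2 * H| < 1 → ∃ s ∈ I, (z s)⁻¹ = y) :
    ContainsProfile τ H d (Set.range (profileSurface τ H d z)) := by
  rcases I.eq_empty_or_nonempty with rfl | ⟨s₀, hs₀⟩
  · exact ⟨0, fun y hy hy' => by simpa using hsurj y hy hy'⟩
  refine ⟨fun y => height τ H d z s₀ + ∫ v in (z s₀)⁻¹..y, profileDeriv τ H d v,
    fun y hy hy' => ⟨?_, fun x => ?_⟩⟩
  · exact (hasDerivAt_integral_profileDeriv (h.mem_profileDomain (hneg _ hs₀))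
      ⟨hy, hy'⟩).const_add _
  · obtain ⟨s, hs, rfl⟩ := hsurj y hy hy'
    refine ⟨(x, s), ?_⟩
    simp only [profileSurface, sweep]
    rw [h.height_eq_add_integral hI hI' hneg hs₀ hs]

end IsReciprocalProfile

/-! ### Annuli, symmetry, properness and embeddedness -/

lemma isAnnulusModParabolic_sweep {y t : ℝ → ℝ} (hy : Continuous y) (ht : Continuous t) :
    IsAnnulusModParabolic (sweep y t) := by
  intro L _
  have hquot : Topology.IsQuotientMap
      (Prod.map ((↑) : ℝ → AddCircle L) (id : ℝ → ℝ)) :=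
    (QuotientAddGroup.isOpenQuotientMap_mk.prodMap IsOpenQuotientMap.id).isQuotientMap
  have hlift : ∀ s, ∀ a b : ℝ, (QuotientAddGroup.leftRel (AddSubgroup.zmultiples L)) a b →
      (Quotient.mk (parabolicSetoid L) (sweep y t (a, s)))
        = Quotient.mk (parabolicSetoid L) (sweep y t (b, s)) := by
    intro s a b hab
    rw [QuotientAddGroup.leftRel_apply, AddSubgroup.mem_zmultiples_iff] at hab
    obtain ⟨n, hn⟩ := hab
    refine Quotient.sound ⟨n, ?_⟩
    ext i
    fin_cases i <;> simp [sweep, parabolicTranslation]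
    simp only [zsmul_eq_mul] at hn
    linarith
  refine ⟨fun p => Quotient.lift (fun x => Quotient.mk (parabolicSetoid L) (sweep y t (x, p.2)))
    (hlift p.2) p.1, ?_, fun x s => rfl⟩
  rw [hquot.continuous_iff]
  have hc : Continuous (sweep y t) := by
    refine continuous_pi fun i => ?_
    fin_cases i
    · exact continuous_fst
    · exact hy.comp continuous_snd
    · exact ht.comp continuous_snd
  exact continuous_quotient_mk'.comp hc

namespace IsReciprocalProfile

variable {τ H d : ℝ} {z z₁ : ℝ → ℝ}

lemma height_zero : height τ H d z 0 = 0 := by simp [height]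

/-- The slope of the height depends on `s` only through `z`, so a reflection symmetry of `z` makes
the derivatives of the two terms cancel. -/
lemma height_add_reflect (h : IsReciprocalProfile H d z z₁) {m : ℝ}
    (hz : ∀ s, z (m - s) = z (m + s)) (s : ℝ) :
    height τ H d z (m + s) + height τ H d z (m - s) = 2 * height τ H d z m := by
  have hder : ∀ s, HasDerivAt (fun s => height τ H d z (m + s) + height τ H d z (m - s)) 0 s := by
    intro s
    refine (((h.hasDerivAt_height (m + s)).comp_const_add m s).add
      ((h.hasDerivAt_height (m - s)).comp_const_sub m s)).congr_deriv ?_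
    rw [hz]; ring
  have := is_const_of_deriv_eq_zero (fun s => (hder s).differentiableAt)
    (fun s => (hder s).deriv) s 0
  simp only [add_zero, sub_zero] at this
  linarith

/-- The two profile velocities at the common point are `(c, σ)` and `(-c, σ)`, up to scaling the
axes. If `c` and `σ` are both nonzero these are independent, so the tangent planes differ. -/
lemma isNonembedded (h : IsReciprocalProfile H d z z₁) {s r : ℝ} (hz : z s = z r)
    (hz₁ : z₁ r = -z₁ s) (hne : z₁ s ≠ 0) (hσ : d / z s - 2 * H ≠ 0)
    (ht : height τ H d z s = height τ H d z r) : IsNonembedded (profileSurface τ H d z) := by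
  refine ⟨(0, s), (0, r), by simp [profileSurface, sweep, hz, ht], fun heq => ?_⟩
  have hmem : fderiv ℝ (profileSurface τ H d z) (0, s) (0, 1)
      ∈ range (fderiv ℝ (profileSurface τ H d z) (0, r)) := heq ▸ mem_range_self _
  obtain ⟨v, hv⟩ := hmem
  rw [profileSurface, fderiv_sweep (h.hasDerivAt_inv _) (h.hasDerivAt_height _),
    fderiv_sweep (h.hasDerivAt_inv _) (h.hasDerivAt_height _)] at hv
  have h1 : v.2 * ((z r)⁻¹ * (-z₁ r / z r)) = 1 * ((z s)⁻¹ * (-z₁ s / z s)) := congrFun hv 1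
  have h2 : v.2 * (vertScale τ * (d / z r - 2 * H)) = 1 * (vertScale τ * (d / z s - 2 * H)) :=
    congrFun hv 2
  rw [← hz, mul_left_inj' (mul_ne_zero (vertScale_pos τ).ne' hσ)] at h2
  have := h.pos s
  rw [h2, ← hz, hz₁, one_mul, one_mul, mul_right_inj' (inv_ne_zero this.ne'),
    div_left_inj' this.ne'] at h1
  exact hne (by linarith)

lemma isAnnulusModParabolic (h : IsReciprocalProfile H d z z₁) :
    IsAnnulusModParabolic (profileSurface τ H d z) :=
  isAnnulusModParabolic_sweep (h.smooth.continuous.inv₀ fun s => (h.pos s).ne')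
    h.contDiff_height.continuous

/-- On a compact set `1/y` is bounded, which confines `s` because `z` tends to infinity; `x` is
confined directly. -/
lemma isProperSurface (h : IsReciprocalProfile H d z z₁) (hz : Tendsto z (cocompact ℝ) atTop) :
    IsProperSurface (profileSurface τ H d z) := by
  intro K hK hKc
  obtain ⟨B, hB⟩ := hKc.bddAbove_image (f := fun q : Coords => (q 1)⁻¹)
    (ContinuousOn.inv₀ (by fun_prop) fun q hq => (hK hq).ne')
  obtain ⟨C, hC, hCB⟩ := mem_cocompact.1 (hz.eventually (eventually_gt_atTop B))
  have hK0 : IsCompact ((fun q : Coords => q 0) '' K) := hKc.image (by fun_prop)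
  refine (hK0.prod hC).of_isClosed_subset
    (hKc.isClosed.preimage h.isCompleteParabolicHSurface.smooth.continuous) ?_
  intro p hp
  refine ⟨⟨_, hp, rfl⟩, ?_⟩
  by_contra hpC
  have h1 : B < z p.2 := hCB hpC
  have h2 : ((z p.2)⁻¹)⁻¹ ≤ B := hB ⟨_, hp, rfl⟩
  rw [inv_inv] at h2
  linarith

lemma sliceReflection_image (h : IsReciprocalProfile H d z z₁) (hz : ∀ s, z (-s) = z s) :
    sliceReflection '' Set.range (profileSurface τ H d z)
      = Set.range (profileSurface τ H d z) := by
  have hodd : ∀ s, height τ H d z (-s) = -height τ H d z s := fun s => by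
    have := h.height_add_reflect (τ := τ) (m := 0) (by simp [hz]) s
    simp only [zero_add, zero_sub, height_zero] at this
    linarith
  have key : ∀ p : ℝ × ℝ, sliceReflection (profileSurface τ H d z p)
      = profileSurface τ H d z (p.1, -p.2) := by
    intro p
    simp [sliceReflection, profileSurface, sweep, hz, hodd]
  ext q
  constructor
  · rintro ⟨_, ⟨p, rfl⟩, rfl⟩
    exact ⟨_, (key p).symm⟩
  · rintro ⟨p, rfl⟩
    exact ⟨_, ⟨(p.1, -p.2), rfl⟩, by rw [key]; simp⟩

lemma verticalTranslation_image {T P : ℝ} (hz : ∀ s, z (s + P) = z s)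
    (ht : ∀ s, height τ H d z (s + P) = height τ H d z s + T) :
    verticalTranslation T '' Set.range (profileSurface τ H d z)
      = Set.range (profileSurface τ H d z) := by
  have key : ∀ p : ℝ × ℝ, verticalTranslation T (profileSurface τ H d z p)
      = profileSurface τ H d z (p.1, p.2 + P) := by
    intro p
    simp [verticalTranslation, profileSurface, sweep, hz, ht]
  ext q
  constructor
  · rintro ⟨_, ⟨p, rfl⟩, rfl⟩
    exact ⟨_, (key p).symm⟩
  · rintro ⟨p, rfl⟩
    exact ⟨_, ⟨(p.1, p.2 - P), rfl⟩, by rw [key]; simp⟩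

lemma isGreatest_range (h : IsReciprocalProfile H d z z₁) {m : ℝ} (hm : ∀ s, z m ≤ z s) :
    IsGreatest (Set.range fun p => profileSurface τ H d z p 1) (z m)⁻¹ := by
  refine ⟨⟨(0, m), rfl⟩, ?_⟩
  rintro _ ⟨p, rfl⟩
  exact inv_anti₀ (h.pos _) (hm _)

/-- Here `σ = d/z - 2H < 0`, so the height is strictly decreasing and the projection to `(x, -t)` is
already an embedding. -/
lemma isEmbedding (h : IsReciprocalProfile H d z z₁) (hd : d < 0) (hH : 0 < H) :
    Topology.IsEmbedding (profileSurface τ H d z) := by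
  have hmono : StrictMono fun s => -height τ H d z s := by
    refine strictMono_of_hasDerivAt_pos (fun s => (h.hasDerivAt_height s).neg) fun s => ?_
    have := div_neg_of_neg_of_pos hd (h.pos s)
    have := mul_neg_of_pos_of_neg (vertScale_pos τ) (show d / z s - 2 * H < 0 by linarith)
    simpa using this
  have hc : Continuous fun s => -height τ H d z s := h.contDiff_height.continuous.neg
  have hemb : Topology.IsEmbedding fun s => -height τ H d z s :=
    hmono.isEmbedding_of_ordConnected (isPreconnected_range hc).ordConnected
  refine Topology.IsEmbedding.of_comp (g := fun q : Coords => (q 0, -q 2))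
    h.isCompleteParabolicHSurface.smooth.continuous (by fun_prop) ?_
  exact Topology.IsEmbedding.id.prodMap hemb

/-- Once `z ≥ |d| / H`, the slope `w(d/z - 2H)` is at most `-wH`. -/
lemma tendsto_height_atBot (h : IsReciprocalProfile H d z z₁) (hH : 0 < H)
    (hz : Tendsto z atTop atTop) : Tendsto (height τ H d z) atTop atBot := by
  obtain ⟨R, hR⟩ := eventually_atTop.1 (hz.eventually (eventually_ge_atTop (|d| / H)))
  have hw := vertScale_pos τ
  have hle : ∀ s, R ≤ s → height τ H d z s - height τ H d z R ≤ -(vertScale τ * H) * (s - R) := by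
    intro s hs
    refine (convex_Ici R).image_sub_le_mul_sub_of_deriv_le
      h.contDiff_height.continuous.continuousOn
      (fun s _ => (h.hasDerivAt_height s).differentiableAt.differentiableWithinAt) ?_ R
      self_mem_Ici s hs hs
    intro r hr
    rw [interior_Ici] at hr
    rw [(h.hasDerivAt_height r).deriv]
    have h1 : d / z r ≤ H := by
      have h2 := hR r (le_of_lt hr)
      rw [div_le_iff₀ hH] at h2
      rw [div_le_iff₀ (h.pos r)]
      linarith [le_abs_self d]
    nlinarith
  refine tendsto_atBot_mono' _ (f₁ := fun s => height τ H d z R + -(vertScale τ * H) * (s - R))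
    ((eventually_ge_atTop R).mono fun s hs => by linarith [hle s hs]) ?_
  refine tendsto_atBot_add_const_left _ _ ?_
  exact (tendsto_atTop_add_const_right atTop (-R) tendsto_id).const_mul_atTop_of_neg
    (by nlinarith [mul_pos hw hH])

end IsReciprocalProfile

/-! ### Explicit solutions of the linear equation -/

/-- `√(1 - 4 H²)`. -/
def kap (H : ℝ) : ℝ := √(1 - 4 * H ^ 2)

lemma kap_sq {H : ℝ} (hH : 0 < H) (hH' : H < 1 / 2) : kap H ^ 2 = 1 - 4 * H ^ 2 :=
  Real.sq_sqrt (by nlinarith)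

lemma kap_pos {H : ℝ} (hH : 0 < H) (hH' : H < 1 / 2) : 0 < kap H :=
  Real.sqrt_pos.2 (by nlinarith)

/-- The reciprocal profile for `H < 1 / 2` and `d ≠ 0`. -/
def coshRecip (H d s : ℝ) : ℝ := (|d| * Real.cosh (kap H * s) - 2 * H * d) / kap H ^ 2

lemma coshRecip_neg (H d s : ℝ) : coshRecip H d (-s) = coshRecip H d s := by
  simp [coshRecip]

/-- The reciprocal profile for `H < 1 / 2` and `d = 0`. -/
def expRecip (H s : ℝ) : ℝ := Real.exp (-(kap H * s))

/-- `√(4 H² - 1)`. -/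
def omg (H : ℝ) : ℝ := √(4 * H ^ 2 - 1)

lemma omg_sq {H : ℝ} (hH : 1 / 2 < H) : omg H ^ 2 = 4 * H ^ 2 - 1 :=
  Real.sq_sqrt (by nlinarith)

lemma omg_pos {H : ℝ} (hH : 1 / 2 < H) : 0 < omg H :=
  Real.sqrt_pos.2 (by nlinarith)

/-- The reciprocal profile for `H > 1 / 2`. -/
def cosRecip (H d s : ℝ) : ℝ := d * (2 * H + Real.cos (omg H * s)) / omg H ^ 2

lemma isReciprocalProfile_coshRecip {H d : ℝ} (hH : 0 < H) (hH' : H < 1 / 2) (hd : d ≠ 0) :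
    IsReciprocalProfile H d (coshRecip H d) (fun s => |d| * Real.sinh (kap H * s) / kap H) := by
  have hk := kap_pos hH hH'
  have hk2 := kap_sq hH hH'
  have hd' := abs_pos.2 hd
  have hlin : ∀ s : ℝ, HasDerivAt (fun s => kap H * s) (kap H) s := fun s => by
    simpa using (hasDerivAt_id s).const_mul (kap H)
  refine ⟨fun s => ?_, ?_, fun s => ?_, fun s => ?_, fun s => ?_⟩
  · have h1 := Real.one_le_cosh (kap H * s)
    have h2 := le_abs_self d
    refine div_pos ?_ (by positivity)
    nlinarith [mul_le_mul_of_nonneg_left h1 hd'.le, mul_le_mul_of_nonneg_left h2 hH.le]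
  · unfold coshRecip
    exact ((contDiff_const.mul (Real.contDiff_cosh.comp
      (contDiff_const.mul contDiff_id))).sub contDiff_const).div_const _
  · refine ((((hlin s).cosh.const_mul |d|).sub_const (2 * H * d)).div_const (kap H ^ 2)).congr_deriv
      ?_
    field_simp
  · refine (((hlin s).sinh.const_mul |d|).div_const (kap H)).congr_deriv ?_
    rw [← hk2, coshRecip]
    field_simp
    ring
  · have h3 := Real.cosh_sq (kap H * s)
    have h4 := sq_abs d
    simp only [coshRecip]
    field_simp
    grind

lemma isReciprocalProfile_expRecip {H : ℝ} (hH : 0 < H) (hH' : H < 1 / 2) :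
    IsReciprocalProfile H 0 (expRecip H) (fun s => -kap H * expRecip H s) := by
  have hk2 := kap_sq hH hH'
  have hder : ∀ s, HasDerivAt (expRecip H) (-kap H * expRecip H s) s := fun s => by
    have := ((hasDerivAt_id s).const_mul (kap H)).neg.exp
    refine this.congr_deriv ?_
    simp [expRecip]
    ring
  refine ⟨fun s => Real.exp_pos _, ?_, hder, fun s => ?_, fun s => ?_⟩
  · exact Real.contDiff_exp.comp (contDiff_const.mul contDiff_id).neg
  · refine ((hder s).const_mul (-kap H)).congr_deriv ?_
    linear_combination expRecip H s * hk2
  · linear_combination -expRecip H s ^ 2 * hk2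

lemma isReciprocalProfile_cosRecip {H d : ℝ} (hH : 1 / 2 < H) (hd : 0 < d) :
    IsReciprocalProfile H d (cosRecip H d) (fun s => -d * Real.sin (omg H * s) / omg H) := by
  have hk := omg_pos hH
  have hk2 := omg_sq hH
  have hlin : ∀ s : ℝ, HasDerivAt (fun s => omg H * s) (omg H) s := fun s => by
    simpa using (hasDerivAt_id s).const_mul (omg H)
  refine ⟨fun s => ?_, ?_, fun s => ?_, fun s => ?_, fun s => ?_⟩
  · have h1 := Real.neg_one_le_cos (omg H * s)
    refine div_pos (mul_pos hd (by linarith)) (by positivity)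
  · unfold cosRecip
    exact (contDiff_const.mul (contDiff_const.add (Real.contDiff_cos.comp
      (contDiff_const.mul contDiff_id)))).div_const _
  · refine ((((hlin s).cos.const_add (2 * H)).const_mul d).div_const (omg H ^ 2)).congr_deriv ?_
    field_simp
  · refine (((hlin s).sin.const_mul (-d)).div_const (omg H)).congr_deriv ?_
    rw [show 1 - 4 * H ^ 2 = -omg H ^ 2 by rw [hk2]; ring, cosRecip]
    field_simp
    ring
  · have h3 := Real.sin_sq_add_cos_sq (omg H * s)
    simp only [cosRecip]
    field_simp
    grind

/-! ### Shape of the surfaces for `H < 1/2` -/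

lemma tendsto_coshRecip {H d : ℝ} (hH : 0 < H) (hH' : H < 1 / 2) (hd : d ≠ 0) :
    Tendsto (coshRecip H d) atTop atTop := by
  have hk := kap_pos hH hH'
  have hcosh : Tendsto Real.cosh atTop atTop := by
    refine tendsto_atTop_mono (f := fun x => Real.exp x / 2) (fun x => ?_)
      (Real.tendsto_exp_atTop.atTop_div_const two_pos)
    rw [Real.cosh_eq]
    linarith [Real.exp_pos (-x)]
  have h1 : Tendsto (fun s => Real.cosh (kap H * s)) atTop atTop :=
    hcosh.comp (tendsto_id.const_mul_atTop hk)
  exact (tendsto_atTop_add_const_right _ (-(2 * H * d))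
    (h1.const_mul_atTop (abs_pos.2 hd))).atTop_div_const (by positivity)

lemma tendsto_coshRecip_cocompact {H d : ℝ} (hH : 0 < H) (hH' : H < 1 / 2) (hd : d ≠ 0) :
    Tendsto (coshRecip H d) (cocompact ℝ) atTop := by
  rw [cocompact_eq_atBot_atTop]
  refine Tendsto.sup ?_ (tendsto_coshRecip hH hH' hd)
  have := (tendsto_coshRecip hH hH' hd).comp tendsto_neg_atBot_atTop
  exact this.congr fun s => coshRecip_neg H d s

lemma coshRecip_zero_inv_of_pos {H d : ℝ} (hH : 0 < H) (hH' : H < 1 / 2) (hd : 0 < d) :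
    (coshRecip H d 0)⁻¹ = (2 * H + 1) / d := by
  simp only [coshRecip, kap_sq hH hH', abs_of_pos hd, mul_zero, Real.cosh_zero, inv_div]
  rw [div_eq_div_iff (ne_of_gt (by nlinarith [mul_pos hd (show 0 < 1 - 2 * H by linarith)])) hd.ne']
  ring

lemma coshRecip_zero_inv_of_neg {H d : ℝ} (hH : 0 < H) (hH' : H < 1 / 2) (hd : d < 0) :
    (coshRecip H d 0)⁻¹ = (1 - 2 * H) / (-d) := by
  have h1 : 1 + 2 * H ≠ 0 := by linarith
  have h2 := hd.ne
  simp only [coshRecip, kap_sq hH hH', abs_of_neg hd, mul_zero, Real.cosh_zero, inv_div]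
  rw [show -d * 1 - 2 * H * d = -d * (1 + 2 * H) by ring]
  field_simp
  ring

lemma coshRecip_zero_le {H d : ℝ} (s : ℝ) : coshRecip H d 0 ≤ coshRecip H d s := by
  unfold coshRecip
  gcongr
  rw [mul_zero, Real.cosh_zero]
  exact Real.one_le_cosh _

lemma exists_coshRecip_eq {H d y : ℝ} (hH : 0 < H) (hH' : H < 1 / 2) (hd : d ≠ 0) (hy : 0 < y)
    (hdy : |d * y - 2 * H| < 1) : ∃ s ∈ Iio (0 : ℝ), (coshRecip H d s)⁻¹ = y := by
  have hk := kap_pos hH hH'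
  have hk2 := kap_sq hH hH'
  have hd' := abs_pos.2 hd
  have hC : 1 < (kap H ^ 2 / y + 2 * H * d) / |d| := by
    rw [one_lt_div hd', hk2, ← sub_pos]
    have hdy' := abs_lt.1 hdy
    rcases lt_or_gt_of_ne hd with h | h
    · rw [abs_of_neg h, show (1 - 4 * H ^ 2) / y + 2 * H * d - -d
        = (1 + 2 * H) * (1 - 2 * H + d * y) / y by field_simp; ring]
      exact div_pos (mul_pos (by linarith) (by linarith)) hy
    · rw [abs_of_pos h, show (1 - 4 * H ^ 2) / y + 2 * H * d - d
        = (1 - 2 * H) * (1 + 2 * H - d * y) / y by field_simp; ring]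
      exact div_pos (mul_pos (by linarith) (by linarith)) hy
  -- Of the two solutions of `cosh (κ s) = C`, with `κ = kap H`, the negative one lies on the branch
  -- where `y` increases.
  refine ⟨-(Real.arcosh ((kap H ^ 2 / y + 2 * H * d) / |d|) / kap H), ?_, ?_⟩
  · have := div_pos (Real.arcosh_pos hC) hk
    simpa using this
  · rw [coshRecip_neg, coshRecip, mul_div_cancel₀ _ hk.ne', Real.cosh_arcosh hC.le]
    field_simp
    ring

lemma coshRecip_deriv_neg {H d s : ℝ} (hH : 0 < H) (hH' : H < 1 / 2) (hd : d ≠ 0) (hs : s < 0) :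
    |d| * Real.sinh (kap H * s) / kap H < 0 := by
  have hk := kap_pos hH hH'
  exact div_neg_of_neg_of_pos (mul_neg_of_pos_of_neg (abs_pos.2 hd)
    (Real.sinh_neg_iff.2 (mul_neg_of_pos_of_neg hk hs))) hk

/-- The height is odd, increases on `[0, m]` while `2H cosh (κ s) < 1`, and finally tends to `-∞`.
Hence it vanishes at some `r > m`, and the parameters `r` and `-r` give the same point with opposite
`c` and nonzero `σ`. -/
lemma isNonembedded_coshRecip {τ H d : ℝ} (hH : 0 < H) (hH' : H < 1 / 2) (hd : 0 < d) :
    IsNonembedded (profileSurface τ H d (coshRecip H d)) := by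
  have hP := isReciprocalProfile_coshRecip hH hH' hd.ne'
  have hk := kap_pos hH hH'
  have hk2 := kap_sq hH hH'
  have hw := vertScale_pos τ
  have hform : ∀ s, d / coshRecip H d s - 2 * H
      = (1 - 2 * H * Real.cosh (kap H * s)) / (coshRecip H d s * kap H ^ 2 / d) := by
    intro s
    have h1 := hP.pos s
    have h2 : d * Real.cosh (kap H * s) = coshRecip H d s * kap H ^ 2 + 2 * H * d := by
      rw [coshRecip, abs_of_pos hd]; field_simp; ring
    field_simp
    linear_combination d * hk2 + 2 * H * h2
  have hden : ∀ s, 0 < coshRecip H d s * kap H ^ 2 / d := fun s => by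
    have := hP.pos s; positivity
  have hC : 1 < 1 / (2 * H) := by rw [one_lt_div (by positivity)]; linarith
  -- The positive zero of `σ`, where the height stops increasing.
  set m := Real.arcosh (1 / (2 * H)) / kap H with hm
  have hm0 : 0 < m := div_pos (Real.arcosh_pos hC) hk
  have hcm : 2 * H * Real.cosh (kap H * m) = 1 := by
    rw [hm, mul_div_cancel₀ _ hk.ne', Real.cosh_arcosh hC.le]; field_simp
  have hcont : Continuous (height τ H d (coshRecip H d)) := hP.contDiff_height.continuous
  have hinc : 0 < height τ H d (coshRecip H d) m := by
    have hsm : StrictMonoOn (height τ H d (coshRecip H d)) (Icc 0 m) := by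
      refine strictMonoOn_of_deriv_pos (convex_Icc 0 m) hcont.continuousOn fun s hs => ?_
      rw [interior_Icc] at hs
      rw [(hP.hasDerivAt_height s).deriv, hform]
      refine mul_pos hw (div_pos ?_ (hden s))
      have : Real.cosh (kap H * s) < Real.cosh (kap H * m) := by
        rw [Real.cosh_lt_cosh, abs_of_pos (mul_pos hk hs.1), abs_of_pos (mul_pos hk hm0)]
        exact mul_lt_mul_of_pos_left hs.2 hk
      nlinarith
    have := hsm (left_mem_Icc.2 hm0.le) (right_mem_Icc.2 hm0.le) hm0
    rwa [IsReciprocalProfile.height_zero] at this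
  obtain ⟨b, hb, hmb⟩ := (((hP.tendsto_height_atBot (τ := τ) hH
    (tendsto_coshRecip hH hH' hd.ne')).eventually (eventually_lt_atBot 0)).and
    (eventually_gt_atTop m)).exists
  obtain ⟨r, hr, hr0⟩ := intermediate_value_Ioo' hmb.le hcont.continuousOn ⟨hb, hinc⟩
  have hr1 : 0 < r := hm0.trans hr.1
  have hodd := hP.height_add_reflect (τ := τ) (m := 0) (by simp [coshRecip_neg]) r
  simp only [zero_add, zero_sub, IsReciprocalProfile.height_zero] at hodd
  refine hP.isNonembedded (s := r) (r := -r) (coshRecip_neg H d r).symm ?_ ?_ ?_ ?_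
  · simp only [mul_neg, Real.sinh_neg]; ring
  · have := Real.sinh_pos_iff.2 (mul_pos hk hr1)
    positivity
  · rw [hform]
    refine div_ne_zero ?_ (hden r).ne'
    have : Real.cosh (kap H * m) < Real.cosh (kap H * r) := by
      rw [Real.cosh_lt_cosh, abs_of_pos (mul_pos hk hr1), abs_of_pos (mul_pos hk hm0)]
      exact mul_lt_mul_of_pos_left hr.1 hk
    nlinarith
  · linarith

/-! ### Shape of the surfaces for `H > 1/2` -/

lemma cosRecip_bounds {H d : ℝ} (hH : 1 / 2 < H) (hd : 0 < d) (s : ℝ) :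
    (2 * H - 1) / d ≤ (cosRecip H d s)⁻¹ ∧ (cosRecip H d s)⁻¹ ≤ (2 * H + 1) / d := by
  have h1 := Real.neg_one_le_cos (omg H * s)
  have h2 := Real.cos_le_one (omg H * s)
  rw [cosRecip, inv_div, omg_sq hH]
  have h3 : 0 < 2 * H + Real.cos (omg H * s) := by linarith
  constructor
  · rw [div_le_div_iff₀ hd (by positivity)]
    nlinarith [mul_nonneg (mul_nonneg hd.le (show 0 ≤ 2 * H - 1 by linarith)) (sub_nonneg.2 h2)]
  · rw [div_le_div_iff₀ (by positivity) hd]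
    nlinarith [mul_nonneg (mul_nonneg hd.le (show 0 ≤ 2 * H + 1 by linarith))
      (neg_le_iff_add_nonneg.1 h1)]

lemma exists_cosRecip_eq {H d y : ℝ} (hH : 1 / 2 < H) (hd : 0 < d) (hy : 0 < y)
    (hdy : |d * y - 2 * H| < 1) :
    ∃ s ∈ Ioo (0 : ℝ) (Real.pi / omg H), (cosRecip H d s)⁻¹ = y := by
  have hk := omg_pos hH
  have hk2 := omg_sq hH
  obtain ⟨hl, hu⟩ := abs_lt.1 hdy
  have h1 : -1 < omg H ^ 2 / (d * y) - 2 * H := by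
    rw [hk2, ← sub_pos, show (4 * H ^ 2 - 1) / (d * y) - 2 * H - -1
      = (2 * H - 1) * (2 * H + 1 - d * y) / (d * y) by field_simp; ring]
    exact div_pos (mul_pos (by linarith) (by linarith)) (by positivity)
  have h2 : omg H ^ 2 / (d * y) - 2 * H < 1 := by
    rw [hk2, ← sub_pos, show 1 - ((4 * H ^ 2 - 1) / (d * y) - 2 * H)
      = (2 * H + 1) * (d * y - (2 * H - 1)) / (d * y) by field_simp; ring]
    exact div_pos (mul_pos (by linarith) (by linarith)) (by positivity)
  refine ⟨Real.arccos (omg H ^ 2 / (d * y) - 2 * H) / omg H, ⟨?_, ?_⟩, ?_⟩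
  · exact div_pos (Real.arccos_pos.2 h2) hk
  · exact div_lt_div_of_pos_right (Real.arccos_lt_pi.2 h1) hk
  · rw [cosRecip, mul_div_cancel₀ _ hk.ne', Real.cos_arccos h1.le h2.le]
    field_simp
    ring

lemma cosRecip_deriv_neg {H d s : ℝ} (hH : 1 / 2 < H) (hd : 0 < d)
    (hs : s ∈ Ioo (0 : ℝ) (Real.pi / omg H)) : -d * Real.sin (omg H * s) / omg H < 0 := by
  have hk := omg_pos hH
  have := Real.sin_pos_of_pos_of_lt_pi (mul_pos hk hs.1) (by
    have := (lt_div_iff₀ hk).1 hs.2; linarith)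
  exact div_neg_of_neg_of_pos (by nlinarith) hk

lemma cosRecip_angle {H d : ℝ} (hH : 1 / 2 < H) (hd : 0 < d) (s : ℝ) :
    d / cosRecip H d s - 2 * H
      = -(1 + 2 * H * Real.cos (omg H * s)) / (2 * H + Real.cos (omg H * s)) := by
  have h1 := Real.neg_one_le_cos (omg H * s)
  have h3 : 0 < 2 * H + Real.cos (omg H * s) := by linarith
  have hk := omg_pos hH
  rw [cosRecip]
  field_simp
  linear_combination omg_sq hH

lemma cosRecip_reflect {H d : ℝ} (hH : 1 / 2 < H) (s : ℝ) :
    cosRecip H d (Real.pi / omg H - s) = cosRecip H d (Real.pi / omg H + s) := by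
  have hk := omg_pos hH
  simp only [cosRecip, mul_add, mul_sub, mul_div_cancel₀ _ hk.ne']
  rw [add_comm Real.pi, Real.cos_add_pi, Real.cos_pi_sub]

lemma cosRecip_neg (H d s : ℝ) : cosRecip H d (-s) = cosRecip H d s := by
  simp [cosRecip]

/-- Pairing `s` with `m - s` flips the sign of the cosine, and the two values of `σ` then have a
negative sum. So `g` decreases from `-t(m)` at `0` to `0` at `m / 2`. -/
lemma height_cosRecip_half_period_neg {τ H d : ℝ} (hH : 1 / 2 < H) (hd : 0 < d) :
    height τ H d (cosRecip H d) (Real.pi / omg H) < 0 := by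
  have hP := isReciprocalProfile_cosRecip hH hd
  have hk := omg_pos hH
  have hw := vertScale_pos τ
  set m := Real.pi / omg H with hm
  have hkm : omg H * m = Real.pi := mul_div_cancel₀ _ hk.ne'
  have hm0 : 0 < m := div_pos Real.pi_pos hk
  set g : ℝ → ℝ := fun s => height τ H d (cosRecip H d) s - height τ H d (cosRecip H d) (m - s)
  have hder : ∀ s, HasDerivAt g (vertScale τ * (d / cosRecip H d s - 2 * H)
      + vertScale τ * (d / cosRecip H d (m - s) - 2 * H)) s := fun s => by
    refine ((hP.hasDerivAt_height s).sub
      ((hP.hasDerivAt_height (m - s)).comp_const_sub m s)).congr_deriv (by ring)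
  have hanti : StrictAntiOn g (Icc 0 (m / 2)) := by
    refine strictAntiOn_of_deriv_neg (convex_Icc _ _)
      (fun s _ => (hder s).continuousAt.continuousWithinAt) fun s hs => ?_
    rw [interior_Icc] at hs
    have hsin := Real.sin_pos_of_pos_of_lt_pi (mul_pos hk hs.1)
      (by rw [← hkm]; exact mul_lt_mul_of_pos_left (by linarith [hs.2]) hk)
    rw [(hder s).deriv, cosRecip_angle hH hd, cosRecip_angle hH hd, mul_sub, hkm, Real.cos_pi_sub,
      ← mul_add]
    refine mul_neg_of_pos_of_neg hw ?_
    have h1 := Real.neg_one_le_cos (omg H * s)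
    have h2 := Real.cos_le_one (omg H * s)
    have h3 : 0 < 2 * H + Real.cos (omg H * s) := by linarith
    have h4 : 0 < 2 * H + -Real.cos (omg H * s) := by linarith
    rw [div_add_div _ _ h3.ne' h4.ne']
    refine div_neg_of_neg_of_pos ?_ (mul_pos h3 h4)
    -- The numerator of the sum is `-4H sin²(ω s)`, with `ω = omg H`.
    have h5 := Real.sin_sq_add_cos_sq (omg H * s)
    have h6 : 0 < H * Real.sin (omg H * s) ^ 2 := by positivity
    nlinarith
  have h1 := hanti (left_mem_Icc.2 (by linarith)) (right_mem_Icc.2 (by linarith)) (half_pos hm0)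
  have h2 : g (m / 2) = 0 := by simp only [g]; rw [sub_half, sub_self]
  have h3 : g 0 = -height τ H d (cosRecip H d) m := by
    simp [g, IsReciprocalProfile.height_zero]
  linarith

/-- The reflections in `0` and in `π / ω` compose to the translation by a period; the two point
symmetries of the height compose to a vertical shift. -/
lemma height_cosRecip_add_period {τ H d : ℝ} (hH : 1 / 2 < H) (hd : 0 < d) (s : ℝ) :
    height τ H d (cosRecip H d) (s + 2 * (Real.pi / omg H))
      = height τ H d (cosRecip H d) s + 2 * height τ H d (cosRecip H d) (Real.pi / omg H) := by
  have hP := isReciprocalProfile_cosRecip hH hd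
  have h1 := hP.height_add_reflect (τ := τ) (m := 0) (by simp [cosRecip_neg]) s
  have h2 := hP.height_add_reflect (τ := τ) (cosRecip_reflect hH) (s + Real.pi / omg H)
  simp only [zero_add, zero_sub, IsReciprocalProfile.height_zero] at h1
  rw [show Real.pi / omg H - (s + Real.pi / omg H) = -s by ring,
    show Real.pi / omg H + (s + Real.pi / omg H) = s + 2 * (Real.pi / omg H) by ring] at h2
  linarith

lemma cosRecip_add_period {H d : ℝ} (hH : 1 / 2 < H) (s : ℝ) :
    cosRecip H d (s + 2 * (Real.pi / omg H)) = cosRecip H d s := by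
  have := cosRecip_reflect (d := d) hH (s + Real.pi / omg H)
  rw [show Real.pi / omg H - (s + Real.pi / omg H) = -s by ring,
    show Real.pi / omg H + (s + Real.pi / omg H) = s + 2 * (Real.pi / omg H) by ring,
    cosRecip_neg] at this
  exact this.symm

/-- About the half period `m` the height rises at first, yet at `2m` it equals twice the negative
number `f m`, so it lies below `f m`. It therefore returns to `f m` at some `m + r`, and by the
point symmetry also at `m - r`. -/
lemma isNonembedded_cosRecip {τ H d : ℝ} (hH : 1 / 2 < H) (hd : 0 < d) :
    IsNonembedded (profileSurface τ H d (cosRecip H d)) := by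
  have hP := isReciprocalProfile_cosRecip hH hd
  have hk := omg_pos hH
  have hw := vertScale_pos τ
  have hneg := height_cosRecip_half_period_neg (τ := τ) hH hd
  have hper := height_cosRecip_add_period (τ := τ) hH hd 0
  have href := cosRecip_reflect (d := d) hH
  set m := Real.pi / omg H with hm
  have hkm : omg H * m = Real.pi := mul_div_cancel₀ _ hk.ne'
  have hm0 : 0 < m := div_pos Real.pi_pos hk
  set f := height τ H d (cosRecip H d)
  have hf : Continuous f := hP.contDiff_height.continuous
  have hcos : ∀ s, Real.cos (omg H * (m + s)) = -Real.cos (omg H * s) := fun s => by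
    rw [mul_add, hkm, add_comm, Real.cos_add_pi]
  -- The first zero of `σ` after `m` is `m + a`, where the cosine equals `-1/(2H)`.
  set a := Real.arccos (1 / (2 * H)) / omg H with ha
  have h2H : 1 / (2 * H) < 1 := by rw [div_lt_one (by linarith)]; linarith
  have h2H' : 0 < 1 / (2 * H) := by positivity
  have ha0 : 0 < a := div_pos (Real.arccos_pos.2 h2H) hk
  have ham : a < m := div_lt_div_of_pos_right (Real.arccos_lt_pi.2 (by linarith)) hk
  have hca : Real.cos (omg H * a) = 1 / (2 * H) := by
    rw [ha, mul_div_cancel₀ _ hk.ne', Real.cos_arccos (by linarith) h2H.le]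
  have hmono : ∀ {s r : ℝ}, 0 ≤ s → r ≤ m → s < r →
      Real.cos (omg H * r) < Real.cos (omg H * s) := fun {s r} hs hr hsr =>
    Real.strictAntiOn_cos ⟨by positivity, by rw [← hkm]; gcongr; linarith⟩
      ⟨mul_nonneg hk.le (by linarith), by rw [← hkm]; gcongr⟩ (mul_lt_mul_of_pos_left hsr hk)
  have hinc : f m < f (m + a) := by
    have hsm : StrictMonoOn f (Icc m (m + a)) := by
      refine strictMonoOn_of_deriv_pos (convex_Icc _ _) hf.continuousOn fun s hs => ?_
      rw [interior_Icc] at hs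
      rw [(hP.hasDerivAt_height s).deriv, cosRecip_angle hH hd]
      have h1 := Real.neg_one_le_cos (omg H * s)
      refine mul_pos hw (div_pos ?_ (by linarith))
      have h2 := hmono (s := s - m) (r := a) (by linarith [hs.1]) ham.le (by linarith [hs.2])
      have h3 := hcos (s - m)
      rw [add_sub_cancel] at h3
      rw [hca] at h2
      rw [h3]
      rw [div_lt_iff₀ (by linarith)] at h2
      linarith
    exact hsm (left_mem_Icc.2 (by linarith)) (right_mem_Icc.2 (by linarith)) (by linarith)
  have hend : f (m + m) < f m := by
    rw [zero_add] at hper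
    rw [← two_mul, hper, show f 0 = 0 from IsReciprocalProfile.height_zero]
    linarith
  obtain ⟨r, hr, hr0⟩ := intermediate_value_Ioo' (a := a) (b := m) (f := fun r => f (m + r))
    ham.le (by fun_prop) ⟨hend, hinc⟩
  simp only at hr0
  have hrefl := hP.height_add_reflect (τ := τ) href r
  have hsin : 0 < Real.sin (omg H * r) := Real.sin_pos_of_pos_of_lt_pi
    (mul_pos hk (ha0.trans hr.1)) (by rw [← hkm]; exact mul_lt_mul_of_pos_left hr.2 hk)
  refine hP.isNonembedded (s := m + r) (r := m - r) (href r).symm ?_ ?_ ?_ ?_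
  · simp only [mul_add, mul_sub, hkm, Real.sin_pi_sub, add_comm Real.pi, Real.sin_add_pi]
    ring
  · simp only [mul_add, hkm, add_comm Real.pi, Real.sin_add_pi]
    simp [hd.ne', hk.ne', hsin.ne']
  · rw [cosRecip_angle hH hd, hcos]
    have h1 := Real.cos_le_one (omg H * r)
    have h2 := hmono ha0.le hr.2.le hr.1
    rw [hca, lt_div_iff₀ (by linarith)] at h2
    exact div_ne_zero (by linarith) (by linarith)
  · change f (m + r) = f (m - r)
    change f (m + r) + f (m - r) = 2 * f m at hrefl
    linarith

/-! ### Smooth convergence as `d` tends to `0` -/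

/-- Differentiating in the second variable is applying the full derivative to `(0, 1)`, so joint
smoothness survives each step. Joint continuity of every `y`-derivative then yields locally uniform
convergence in the parameter. -/
lemma contDiffOn_iteratedDeriv_snd {G : ℝ × ℝ → ℝ} {U : Set (ℝ × ℝ)} (hU : IsOpen U)
    (hG : ContDiffOn ℝ ∞ G U) (k : ℕ) :
    ContDiffOn ℝ ∞ (fun q : ℝ × ℝ => iteratedDeriv k (fun y => G (q.1, y)) q.2) U := by
  induction k with
  | zero => simpa using hG
  | succ k ih =>
    have h1 : ContDiffOn ℝ ∞ (fun q => fderiv ℝ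
        (fun q : ℝ × ℝ => iteratedDeriv k (fun y => G (q.1, y)) q.2) q (0, 1)) U :=
      (ih.fderiv_of_isOpen hU (m := ∞) (by simp)).clm_apply contDiffOn_const
    refine h1.congr fun q hq => ?_
    rw [iteratedDeriv_succ]
    have h2 := ((ih.contDiffAt (hU.mem_nhds hq)).differentiableAt (by simp)).hasFDerivAt
    have h3 : HasDerivAt (fun y : ℝ => (q.1, y)) ((0, 1) : ℝ × ℝ) q.2 :=
      (hasDerivAt_const _ _).prodMk (hasDerivAt_id _)
    exact (h2.comp_hasDerivAt q.2 h3).deriv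

lemma tendstoLocallyUniformlyOn_of_continuousOn {A : ℝ × ℝ → ℝ} {U : Set (ℝ × ℝ)} (hU : IsOpen U)
    (hA : ContinuousOn A U) {s : Set ℝ} (hs : IsOpen s) {d₀ : ℝ} (hsU : ∀ y ∈ s, (d₀, y) ∈ U) :
    TendstoLocallyUniformlyOn (fun d y => A (d, y)) (fun y => A (d₀, y)) (𝓝 d₀) s := by
  rw [hs.tendstoLocallyUniformlyOn_iff_forall_tendsto]
  intro y hy
  have h1 : ContinuousAt A (d₀, y) := hA.continuousAt (hU.mem_nhds (hsU y hy))
  have h2 : Tendsto (fun q : ℝ × ℝ => A (d₀, q.2)) (𝓝 (d₀, y)) (𝓝 (A (d₀, y))) :=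
    Tendsto.comp (f := fun q : ℝ × ℝ => (d₀, q.2)) h1
      (Continuous.tendsto' (by fun_prop) _ _ rfl)
  rw [← nhds_prod_eq]
  exact (h2.prodMk_nhds h1).mono_right (nhds_le_uniformity _)

lemma eventually_mem_profileDomain {H : ℝ} (hH : 0 < H) (hH' : H < 1 / 2) (M : ℝ) :
    ∀ᶠ d in 𝓝 (0 : ℝ), ∀ y, 0 < y → y ≤ M → (d, y) ∈ profileDomain H := by
  have h : Tendsto (fun d : ℝ => |d| * M) (𝓝 0) (𝓝 0) :=
    Continuous.tendsto' (by fun_prop) _ _ (by simp)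
  filter_upwards [h.eventually (gt_mem_nhds (show 0 < 1 - 2 * H by linarith))] with d hd y hy hyM
  refine ⟨hy, ?_⟩
  have h1 : |d * y| ≤ |d| * M := by
    rw [abs_mul, abs_of_pos hy]; exact mul_le_mul_of_nonneg_left hyM (abs_nonneg d)
  have := abs_le.1 h1
  rw [abs_lt]
  constructor <;> simp only <;> linarith

/-- The primitive of `profileDeriv` that vanishes at `y = 1`. -/
def profilePrimitive (τ H d y : ℝ) : ℝ := ∫ v in (1 : ℝ)..y, profileDeriv τ H d v

lemma hasDerivAt_profilePrimitive {τ H d y : ℝ} (h1 : (d, 1) ∈ profileDomain H)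
    (hy : (d, y) ∈ profileDomain H) :
    HasDerivAt (profilePrimitive τ H d) (profileDeriv τ H d y) y :=
  hasDerivAt_integral_profileDeriv h1 hy

lemma isOpen_profileDomain_section (H d : ℝ) : IsOpen {y | (d, y) ∈ profileDomain H} :=
  (isOpen_profileDomain H).preimage (by fun_prop)

lemma contDiffOn_profilePrimitive {τ H d : ℝ} (h1 : (d, 1) ∈ profileDomain H) :
    ContDiffOn ℝ ∞ (profilePrimitive τ H d) {y | (d, y) ∈ profileDomain H} := by
  rw [contDiffOn_infty_iff_deriv_of_isOpen (isOpen_profileDomain_section H d)]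
  refine ⟨fun y hy => (hasDerivAt_profilePrimitive h1 hy).differentiableAt.differentiableWithinAt,
    ?_⟩
  refine ContDiffOn.congr (f := profileDeriv τ H d) ?_
    fun y hy => (hasDerivAt_profilePrimitive h1 hy).deriv
  exact (contDiffOn_profileDeriv τ H).comp (f := fun y : ℝ => (d, y))
    (contDiff_const.prodMk contDiff_id).contDiffOn fun y hy => hy

lemma iteratedDeriv_succ_profilePrimitive {τ H d y : ℝ} (h1 : (d, 1) ∈ profileDomain H)
    (hy : (d, y) ∈ profileDomain H) (k : ℕ) :
    iteratedDeriv (k + 1) (profilePrimitive τ H d) y = iteratedDeriv k (profileDeriv τ H d) y := by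
  rw [iteratedDeriv_succ']
  refine Filter.EventuallyEq.iteratedDeriv_eq k ?_
  filter_upwards [(isOpen_profileDomain_section H d).mem_nhds hy] with v hv
  exact (hasDerivAt_profilePrimitive h1 hv).deriv

lemma tendstoLocallyUniformlyOn_iteratedDeriv_profileDeriv {τ H : ℝ} (hH : 0 < H)
    (hH' : H < 1 / 2) (k : ℕ) :
    TendstoLocallyUniformlyOn (fun d => iteratedDeriv k (profileDeriv τ H d))
      (iteratedDeriv k (profileDeriv τ H 0)) (𝓝 0) (Ioi 0) :=
  tendstoLocallyUniformlyOn_of_continuousOn (isOpen_profileDomain H)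
    (contDiffOn_iteratedDeriv_snd (isOpen_profileDomain H)
      (contDiffOn_profileDeriv τ H) k).continuousOn isOpen_Ioi
    fun y hy => (eventually_mem_profileDomain hH hH' y).self_of_nhds y hy le_rfl

lemma exists_Icc_of_isCompact {K : Set ℝ} (hK : IsCompact K) (hK0 : K ⊆ Ioi 0) :
    ∃ a b : ℝ, 0 < a ∧ a ≤ 1 ∧ 1 ≤ b ∧ K ⊆ Icc a b := by
  rcases K.eq_empty_or_nonempty with rfl | hne
  · exact ⟨1, 1, one_pos, le_rfl, le_rfl, empty_subset _⟩
  obtain ⟨m, hm, hmin⟩ := hK.exists_isLeast hne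
  obtain ⟨b, hb⟩ := hK.bddAbove
  exact ⟨min m 1, max b 1, lt_min (hK0 hm) one_pos, min_le_right _ _, le_max_right _ _,
    fun y hy => ⟨(min_le_left _ _).trans (hmin hy), (hb hy).trans (le_max_left _ _)⟩⟩

lemma tendstoUniformlyOn_profilePrimitive {τ H : ℝ} (hH : 0 < H) (hH' : H < 1 / 2) {K : Set ℝ}
    (hK : IsCompact K) (hK0 : K ⊆ Ioi 0) :
    TendstoUniformlyOn (profilePrimitive τ H) (profilePrimitive τ H 0) (𝓝 0) K := by
  obtain ⟨a, b, ha, ha1, hb1, hKab⟩ := exists_Icc_of_isCompact hK hK0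
  refine TendstoUniformlyOn.mono ?_ hKab
  have h0 := tendstoLocallyUniformlyOn_iteratedDeriv_profileDeriv (τ := τ) hH hH' 0
  simp only [iteratedDeriv_zero] at h0
  have h1 := (tendstoLocallyUniformlyOn_iff_forall_isCompact isOpen_Ioi).1 h0 (Icc a b)
    (fun y hy => ha.trans_le hy.1) isCompact_Icc
  rw [Metric.tendstoUniformlyOn_iff] at h1 ⊢
  intro ε hε
  have hb0 : 0 < b := by linarith
  filter_upwards [h1 (ε / (2 * b)) (by positivity), eventually_mem_profileDomain hH hH' b]
    with d hd hdom y hy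
  have hdom0 := (eventually_mem_profileDomain hH hH' b).self_of_nhds
  have hsub : uIcc 1 y ⊆ Icc a b := ordConnected_Icc.uIcc_subset ⟨ha1, hb1⟩ hy
  have hint : ∀ e : ℝ, (∀ y, 0 < y → y ≤ b → (e, y) ∈ profileDomain H) →
      IntervalIntegrable (profileDeriv τ H e) volume 1 y := fun e he =>
    (continuousOn_profileDeriv.mono fun v hv =>
      he v (ha.trans_le (hsub hv).1) (hsub hv).2).intervalIntegrable
  rw [Real.dist_eq, profilePrimitive, profilePrimitive,
    ← intervalIntegral.integral_sub (hint 0 hdom0) (hint d hdom)]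
  have hle := intervalIntegral.norm_integral_le_of_norm_le_const (a := 1) (b := y)
    (f := fun v => profileDeriv τ H 0 v - profileDeriv τ H d v) (C := ε / (2 * b)) fun v hv => by
      have := hd v (hsub (uIoc_subset_uIcc hv))
      rw [Real.dist_eq] at this
      exact this.le
  refine hle.trans_lt ?_
  -- The factor `2 * b` in the tolerance bounds the length of the integration interval from `1` to
  -- `y`.
  have h2 : |y - 1| < 2 * b := by
    rw [abs_lt]; constructor <;> linarith [hy.1, hy.2]
  calc ε / (2 * b) * |y - 1| < ε / (2 * b) * (2 * b) :=
        mul_lt_mul_of_pos_left h2 (by positivity)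
    _ = ε := by field_simp

lemma tendstoLocallyUniformlyOn_iteratedDeriv_profilePrimitive {τ H : ℝ} (hH : 0 < H)
    (hH' : H < 1 / 2) (k : ℕ) :
    TendstoLocallyUniformlyOn (fun d => iteratedDeriv k (profilePrimitive τ H d))
      (iteratedDeriv k (profilePrimitive τ H 0)) (𝓝 0) (Ioi 0) := by
  rw [tendstoLocallyUniformlyOn_iff_forall_isCompact isOpen_Ioi]
  intro K hK0 hK
  cases k with
  | zero =>
    simp only [iteratedDeriv_zero]
    exact tendstoUniformlyOn_profilePrimitive hH hH' hK hK0
  | succ k =>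
    obtain ⟨a, b, ha, ha1, hb1, hKab⟩ := exists_Icc_of_isCompact hK hK0
    have hdom := eventually_mem_profileDomain hH hH' b
    have hEq : ∀ᶠ d in 𝓝 (0 : ℝ), EqOn (iteratedDeriv k (profileDeriv τ H d))
        (iteratedDeriv (k + 1) (profilePrimitive τ H d)) K := by
      filter_upwards [hdom] with d hd y hy
      exact (iteratedDeriv_succ_profilePrimitive (hd 1 one_pos hb1)
        (hd y (hK0 hy) (hKab hy).2) k).symm
    exact (((tendstoLocallyUniformlyOn_iff_forall_isCompact isOpen_Ioi).1
      (tendstoLocallyUniformlyOn_iteratedDeriv_profileDeriv hH hH' k) K hK0 hK).congr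
        hEq).congr_right hEq.self_of_nhds

lemma hasDerivAt_limitProfile {τ H y : ℝ} (hy : 0 < y) :
    HasDerivAt (limitProfile τ H) (profileDeriv τ H 0 y) y := by
  have h := (((Real.hasDerivAt_log hy.ne').const_mul
    (-2 * √(1 + 4 * τ ^ 2) * H)).div_const (√(1 - 4 * H ^ 2)))
  refine h.congr_deriv ?_
  rw [profileDeriv, show (0 * y - 2 * H) ^ 2 = 4 * H ^ 2 by ring, zero_mul, zero_sub, mul_comm y,
    ← div_div, ← div_eq_mul_inv]
  ring

lemma profilePrimitive_zero {τ H y : ℝ} (hH : 0 < H) (hH' : H < 1 / 2) (hy : 0 < y) :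
    profilePrimitive τ H 0 y = limitProfile τ H y := by
  have hpos : ∀ v ∈ uIcc 1 y, 0 < v := fun v hv =>
    (lt_min one_pos hy).trans_le hv.1
  rw [profilePrimitive, intervalIntegral.integral_eq_sub_of_hasDerivAt
    (fun v hv => hasDerivAt_limitProfile (hpos v hv))
    (continuousOn_profileDeriv.mono fun v hv =>
      (eventually_mem_profileDomain hH hH' v).self_of_nhds v (hpos v hv) le_rfl).intervalIntegrable]
  simp [limitProfile]

/-- The reciprocal profile is positively homogeneous in `d`, so `d / z` is unchanged. Geometrically,
the dilations `(x, y, t) ↦ (λx, λy, t)` are isometries. -/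
lemma height_coshRecip_mul {τ H c d : ℝ} (hc : 0 < c) :
    height τ H (c * d) (coshRecip H (c * d)) = height τ H d (coshRecip H d) := by
  have h : ∀ s, coshRecip H (c * d) s = c * coshRecip H d s := fun s => by
    rw [coshRecip, coshRecip, abs_mul, abs_of_pos hc]; ring
  ext s
  simp only [height, h, mul_div_mul_left _ _ hc.ne']

/-- By homogeneity the height function is that of `d = 1` or `d = -1`, and it tends to `+∞` as `s →
-∞`. For small `|d|` the parameter at which `y = 1` must lie far out, since `z = 1` needs a large
hyperbolic cosine. -/
lemma eventually_lt_height_coshRecip {τ H : ℝ} (hH : 0 < H) (hH' : H < 1 / 2) (B : ℝ) :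
    ∀ᶠ d in 𝓝[≠] (0 : ℝ), ∀ s < 0, coshRecip H d s = 1 →
      B < height τ H d (coshRecip H d) s := by
  have hk := kap_pos hH hH'
  have hunit : ∀ d : ℝ, d ≠ 0 → ∀ᶠ s in atTop, B < height τ H d (coshRecip H d) (-s) := by
    intro d hd
    have hP := isReciprocalProfile_coshRecip hH hH' hd
    filter_upwards [(hP.tendsto_height_atBot (τ := τ) hH
      (tendsto_coshRecip hH hH' hd)).eventually (eventually_lt_atBot (-B))] with s hs
    have hodd := hP.height_add_reflect (τ := τ) (m := 0) (by simp [coshRecip_neg]) s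
    simp only [zero_add, zero_sub, IsReciprocalProfile.height_zero] at hodd
    linarith
  obtain ⟨R, hR⟩ := eventually_atTop.1 ((hunit 1 one_ne_zero).and (hunit (-1) (by norm_num)))
  -- An upper bound for `z` on `|s| ≤ R`; once it drops below `1`, the value `z = 1` is taken only
  -- beyond `R`.
  have hlim : Tendsto (fun d : ℝ => |d| * (Real.cosh (kap H * R) + 2 * H) / kap H ^ 2) (𝓝 0)
      (𝓝 0) := Continuous.tendsto' (by fun_prop) _ _ (by simp)
  filter_upwards [self_mem_nhdsWithin,
    (hlim.eventually (gt_mem_nhds one_pos)).filter_mono nhdsWithin_le_nhds] with d hd hsmall s hs hs1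
  have hsR : R ≤ -s := by
    by_contra hlt
    push Not at hlt
    have h1 : Real.cosh (kap H * s) ≤ Real.cosh (kap H * R) := by
      rw [Real.cosh_le_cosh, abs_of_neg (mul_neg_of_pos_of_neg hk hs),
        abs_of_pos (mul_pos hk (by linarith))]
      nlinarith
    have h2 : coshRecip H d s ≤ |d| * (Real.cosh (kap H * R) + 2 * H) / kap H ^ 2 := by
      unfold coshRecip
      gcongr
      have := mul_le_mul_of_nonneg_left h1 (abs_nonneg d)
      have := mul_le_mul_of_nonneg_left (neg_le_abs d) hH.le
      linarith
    linarith
  have h := hR (-s) hsR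
  rw [neg_neg] at h
  rcases lt_or_gt_of_ne hd with hd | hd
  · have h3 := height_coshRecip_mul (τ := τ) (H := H) (d := -1) (neg_pos.2 hd)
    rw [neg_mul_neg, mul_one] at h3
    rw [h3]
    exact h.2
  · have h3 := height_coshRecip_mul (τ := τ) (H := H) (d := 1) hd
    rw [mul_one] at h3
    rw [h3]
    exact h.1

/-- The translation puts the point `y = 1` of the branch `s < 0` at height `0`, which makes that
branch the graph of `profilePrimitive`. By oddness the branch `s > 0` then has height minus
`profilePrimitive` minus twice the original height at `base d`, and so sinks below any compact set.
-/
theorem exists_tendsSmoothlyToGraph {τ H : ℝ} (hH : 0 < H) (hH' : H < 1 / 2)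
    {S : ℝ → Set Coords}
    (hS : ∀ d ≠ 0, S d = Set.range (profileSurface τ H d (coshRecip H d))) :
    ∃ a : ℝ → ℝ, TendsSmoothlyToGraph (fun d => verticalTranslation (a d) '' S d)
      (limitProfile τ H) := by
  have hbase : ∀ d : ℝ, ∃ s : ℝ, d ≠ 0 → (d, 1) ∈ profileDomain H → s < 0 ∧ coshRecip H d s = 1 := by
    intro d
    by_cases hd : d ≠ 0 ∧ (d, (1 : ℝ)) ∈ profileDomain H
    · obtain ⟨s, hs, hs1⟩ := exists_coshRecip_eq hH hH' hd.1 one_pos hd.2.2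
      exact ⟨s, fun _ _ => ⟨hs, inv_eq_one.1 hs1⟩⟩
    · exact ⟨0, fun h1 h2 => (hd ⟨h1, h2⟩).elim⟩
  choose base hbase using hbase
  refine ⟨fun d => -height τ H d (coshRecip H d) (base d), profilePrimitive τ H, ?_, ?_, ?_⟩
  · intro K hK hKc
    have hK1c : IsCompact ((fun q : Coords => q 1) '' K) := hKc.image (by fun_prop)
    have hK1 : (fun q : Coords => q 1) '' K ⊆ Ioi 0 := by
      rintro _ ⟨q, hq, rfl⟩; exact hK hq
    obtain ⟨m, M, hm, hm1, hM1, hKM⟩ := exists_Icc_of_isCompact hK1c hK1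
    obtain ⟨B, hB⟩ := (hKc.image (f := fun q : Coords => q 2) (by fun_prop)).bddBelow
    obtain ⟨B₁, hB₁⟩ := hK1c.bddBelow_image (f := profilePrimitive τ H 0)
      ((contDiffOn_profilePrimitive ((eventually_mem_profileDomain hH hH' 1).self_of_nhds 1 one_pos
        le_rfl)).continuousOn.mono fun y hy =>
          (eventually_mem_profileDomain hH hH' y).self_of_nhds y (hK1 hy) le_rfl)
    have hunif := Metric.tendstoUniformlyOn_iff.1
      (tendstoUniformlyOn_profilePrimitive (τ := τ) hH hH' hK1c hK1) 1 one_pos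
    -- With `B` below the heights in `K`, `B₁` below the limit primitive and closeness `1`, a base
    -- height above `(1 - B - B₁) / 2` pushes the second branch below `B`.
    filter_upwards [self_mem_nhdsWithin, hunif.filter_mono nhdsWithin_le_nhds,
      (eventually_mem_profileDomain hH hH' M).filter_mono nhdsWithin_le_nhds,
      eventually_lt_height_coshRecip (τ := τ) hH hH' ((1 - B - B₁) / 2)]
      with d hd hclose hdom hlarge q hq
    have hP := isReciprocalProfile_coshRecip hH hH' hd
    have hd1 := hdom 1 one_pos hM1
    obtain ⟨hb0, hb1⟩ := hbase d hd hd1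
    have hbranch : ∀ s < 0, height τ H d (coshRecip H d) s
        = height τ H d (coshRecip H d) (base d) + profilePrimitive τ H d (coshRecip H d s)⁻¹ := by
      intro s hs
      rw [hP.height_eq_add_integral isOpen_Iio isPreconnected_Iio
        (fun s hs => coshRecip_deriv_neg hH hH' hd hs) (show base d ∈ Iio 0 from hb0) hs, hb1,
        inv_one, profilePrimitive]
    have hqy : (fun q : Coords => q 1) q ∈ (fun q : Coords => q 1) '' K := ⟨q, hq, rfl⟩
    have hqdom := hdom (q 1) (hK1 hqy) (hKM hqy).2
    rw [hS d hd]
    constructor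
    · rintro ⟨_, ⟨p, rfl⟩, hpq⟩
      have hq1 : (coshRecip H d p.2)⁻¹ = q 1 := congrFun hpq 1
      have hq2 : height τ H d (coshRecip H d) p.2 + -height τ H d (coshRecip H d) (base d) = q 2 :=
        congrFun hpq 2
      rcases lt_trichotomy p.2 0 with hs | hs | hs
      · rw [hbranch _ hs, hq1] at hq2
        linarith
      -- At `s = 0` the tangent is vertical in the orbit space, `σ² = 1`, which the domain condition
      -- `|dy - 2H| < 1` excludes.
      · have h1 := hP.angle_sq p.2
        have h2 := (sq_lt_one_iff_abs_lt_one _).2 hqdom.2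
        simp only [← hq1] at h2
        rw [hs, mul_zero, Real.sinh_zero] at h1
        rw [hs, ← div_eq_mul_inv] at h2
        norm_num at h1 h2
        rcases h1 with h1 | h1 <;> rw [h1] at h2 <;> norm_num at h2
      · exfalso
        have hodd := hP.height_add_reflect (τ := τ) (m := 0) (by simp [coshRecip_neg]) p.2
        simp only [zero_add, zero_sub, IsReciprocalProfile.height_zero] at hodd
        have h1 := hbranch (-p.2) (by linarith)
        rw [coshRecip_neg, hq1] at h1
        have h2 := hlarge _ hb0 hb1
        have h3 : B ≤ q 2 := hB ⟨q, hq, rfl⟩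
        have h4 : B₁ ≤ profilePrimitive τ H 0 (q 1) := hB₁ ⟨_, hqy, rfl⟩
        have h5 := hclose _ hqy
        rw [Real.dist_eq, abs_lt] at h5
        simp only at h5
        linarith [h5.2]
    · intro hq2
      obtain ⟨s, hs, hsy⟩ := exists_coshRecip_eq hH hH' hd hqdom.1 hqdom.2
      refine ⟨_, ⟨(q 0, s), rfl⟩, ?_⟩
      ext i
      fin_cases i
      · rfl
      · exact hsy
      · change height τ H d (coshRecip H d) s + -height τ H d (coshRecip H d) (base d) = q 2
        rw [hbranch s hs, hsy, hq2]
        ring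
  · intro C hC hCc
    obtain ⟨a, b, ha, ha1, hb1, hCab⟩ := exists_Icc_of_isCompact hCc hC
    filter_upwards [(eventually_mem_profileDomain hH hH' b).filter_mono nhdsWithin_le_nhds]
      with d hd
    exact ⟨_, isOpen_profileDomain_section H d, fun y hy => hd y (hC hy) (hCab hy).2,
      contDiffOn_profilePrimitive (hd 1 one_pos hb1)⟩
  · intro k
    have hlim : EqOn (iteratedDeriv k (profilePrimitive τ H 0))
        (iteratedDeriv k (limitProfile τ H)) (Ioi 0) := fun y hy =>
      Filter.EventuallyEq.iteratedDeriv_eq k <| by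
        filter_upwards [isOpen_Ioi.mem_nhds hy] with v hv using profilePrimitive_zero hH hH' hv
    have h := tendstoLocallyUniformlyOn_iteratedDeriv_profilePrimitive (τ := τ) hH hH' k
    rw [tendstoLocallyUniformlyOn_iff_forall_isCompact isOpen_Ioi] at h ⊢
    intro K hK hKc u hu
    exact (((h K hK hKc).congr_right (hlim.mono hK)) u hu).filter_mono nhdsWithin_le_nhds

lemma range_profileSurface_expRecip {τ H : ℝ} (hH : 0 < H) (hH' : H < 1 / 2) :
    Set.range (profileSurface τ H 0 (expRecip H)) = graphOf (limitProfile τ H) := by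
  have hk := kap_pos hH hH'
  have hh : ∀ s, height τ H 0 (expRecip H) s = -2 * vertScale τ * H * s := fun s => by
    simp [height]; ring
  have hF : ∀ s, limitProfile τ H (expRecip H s)⁻¹ = -2 * vertScale τ * H * s := fun s => by
    rw [limitProfile, ← vertScale, ← kap, expRecip, ← Real.exp_neg, Real.log_exp]
    field_simp
  ext q
  constructor
  · rintro ⟨p, rfl⟩
    exact ⟨inv_pos.2 (Real.exp_pos _), (hh p.2).trans (hF p.2).symm⟩
  · rintro ⟨hq, hq2⟩
    have hy : (expRecip H (Real.log (q 1) / kap H))⁻¹ = q 1 := by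
      rw [expRecip, mul_div_cancel₀ _ hk.ne', ← Real.exp_neg, neg_neg, Real.exp_log hq]
    refine ⟨(q 0, Real.log (q 1) / kap H), ?_⟩
    ext i
    fin_cases i
    · rfl
    · exact hy
    · change height τ H 0 (expRecip H) (Real.log (q 1) / kap H) = q 2
      rw [hh, ← hF, hy, hq2]

/-! ### The family and the theorem -/

/-- The family of parabolic `H`-surfaces. -/
def parabolicFamily (τ H d : ℝ) : ℝ × ℝ → Coords :=
  if H < 1 / 2 then
    if d = 0 then profileSurface τ H 0 (expRecip H) else profileSurface τ H d (coshRecip H d)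
  else profileSurface τ H d (cosRecip H d)

end ParabolicPSL

end

theorem mainTheorem3 (τ H : ℝ) (hH : 0 < H) (hH' : H ≠ 1 / 2) :
    ∃ P : ℝ → ℝ × ℝ → Coords,
      -- the family is indexed by all real `d` if `H < 1/2`, by all `d > 0` if `H > 1/2`
      (∀ d : ℝ, (H < 1 / 2 ∨ 0 < d) →
        IsCompleteParabolicHSurface τ H (P d) ∧ ContainsProfile τ H d (Set.range (P d))) ∧
      (1 / 2 < H → ∀ d : ℝ, 0 < d →
        IsNonembedded (P d) ∧
        IsAnnulusModParabolic (P d) ∧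
        (∃ T : ℝ, T ≠ 0 ∧ verticalTranslation T '' Set.range (P d) = Set.range (P d)) ∧
        ∀ p, (2 * H - 1) / d ≤ P d p 1 ∧ P d p 1 ≤ (2 * H + 1) / d) ∧
      (H < 1 / 2 → ∀ d : ℝ, 0 < d →
        IsProperSurface (P d) ∧
        IsNonembedded (P d) ∧
        IsAnnulusModParabolic (P d) ∧
        sliceReflection '' Set.range (P d) = Set.range (P d) ∧
        IsGreatest (Set.range fun p => P d p 1) ((2 * H + 1) / d)) ∧
      (H < 1 / 2 → ∀ d : ℝ, d < 0 →
        IsProperSurface (P d) ∧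
        Topology.IsEmbedding (P d) ∧
        IsAnnulusModParabolic (P d) ∧
        sliceReflection '' Set.range (P d) = Set.range (P d) ∧
        IsGreatest (Set.range fun p => P d p 1) ((1 - 2 * H) / (-d))) ∧
      (H < 1 / 2 →
        Set.range (P 0) = graphOf (limitProfile τ H) ∧
        ∃ a : ℝ → ℝ, TendsSmoothlyToGraph
          (fun d => verticalTranslation (a d) '' Set.range (P d)) (limitProfile τ H)) := by
  have hcosh : ∀ d ≠ 0, H < 1 / 2 →
      parabolicFamily τ H d = profileSurface τ H d (coshRecip H d) := fun d hd h => by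
    rw [parabolicFamily, if_pos h, if_neg hd]
  have hexp : H < 1 / 2 → parabolicFamily τ H 0 = profileSurface τ H 0 (expRecip H) := fun h => by
    rw [parabolicFamily, if_pos h, if_pos rfl]
  have hcos : 1 / 2 < H → ∀ d, parabolicFamily τ H d = profileSurface τ H d (cosRecip H d) :=
    fun h d => if_neg h.not_gt
  refine ⟨parabolicFamily τ H, fun d hd => ?_, fun h d hd => ?_, fun h d hd => ?_,
    fun h d hd => ?_, fun h => ⟨?_, ?_⟩⟩
  · rcases lt_or_gt_of_ne hH' with h | h
    · rcases eq_or_ne d 0 with rfl | hd0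
      · have hP := isReciprocalProfile_expRecip hH h
        rw [hexp h]
        refine ⟨hP.isCompleteParabolicHSurface, hP.containsProfile isOpen_univ isPreconnected_univ
          (fun s _ => ?_) fun y hy _ => ⟨Real.log y / kap H, mem_univ _, ?_⟩⟩
        · exact mul_neg_of_neg_of_pos (neg_lt_zero.2 (kap_pos hH h)) (Real.exp_pos _)
        · rw [expRecip, mul_div_cancel₀ _ (kap_pos hH h).ne', ← Real.exp_neg, neg_neg,
            Real.exp_log hy]
      · have hP := isReciprocalProfile_coshRecip hH h hd0
        rw [hcosh d hd0 h]
        exact ⟨hP.isCompleteParabolicHSurface, hP.containsProfile isOpen_Iio isPreconnected_Iio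
          (fun s hs => coshRecip_deriv_neg hH h hd0 hs)
          fun y hy hdy => exists_coshRecip_eq hH h hd0 hy hdy⟩
    · have hd' : 0 < d := hd.resolve_left h.not_gt
      have hP := isReciprocalProfile_cosRecip h hd'
      rw [hcos h d]
      exact ⟨hP.isCompleteParabolicHSurface, hP.containsProfile isOpen_Ioo isPreconnected_Ioo
        (fun s hs => cosRecip_deriv_neg h hd' hs) fun y hy hdy => exists_cosRecip_eq h hd' hy hdy⟩
  · have hP := isReciprocalProfile_cosRecip h hd
    rw [hcos h d]
    exact ⟨isNonembedded_cosRecip h hd, hP.isAnnulusModParabolic,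
      ⟨_, mul_ne_zero two_ne_zero (height_cosRecip_half_period_neg (τ := τ) h hd).ne,
        IsReciprocalProfile.verticalTranslation_image (cosRecip_add_period h)
          (height_cosRecip_add_period h hd)⟩, fun p => cosRecip_bounds h hd p.2⟩
  · have hP := isReciprocalProfile_coshRecip hH h hd.ne'
    rw [hcosh d hd.ne' h, ← coshRecip_zero_inv_of_pos hH h hd]
    exact ⟨hP.isProperSurface (tendsto_coshRecip_cocompact hH h hd.ne'),
      isNonembedded_coshRecip hH h hd, hP.isAnnulusModParabolic,
      hP.sliceReflection_image (coshRecip_neg H d), hP.isGreatest_range coshRecip_zero_le⟩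
  · have hP := isReciprocalProfile_coshRecip hH h hd.ne
    rw [hcosh d hd.ne h, ← coshRecip_zero_inv_of_neg hH h hd]
    exact ⟨hP.isProperSurface (tendsto_coshRecip_cocompact hH h hd.ne),
      hP.isEmbedding hd hH, hP.isAnnulusModParabolic,
      hP.sliceReflection_image (coshRecip_neg H d), hP.isGreatest_range coshRecip_zero_le⟩
  · rw [hexp h, range_profileSurface_expRecip hH h]
  · exact exists_tendsSmoothlyToGraph hH h fun d hd => by rw [hcosh d hd h]
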